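/- **Proposition 4.1** (existence and entropy dissipation for the nonlinear DDFV scheme, no-flux boundary conditions). *Domain and data.* Let $\Omega\subset\mathbb R^2$ be a bounded connected open polygonal domain, $V\in C^1(\overline\Omega)$, $u_0\in L^2(\Omega)$ with $u_0\ge 0$ a.e. and $M^1:=\int_\Omega u_0>0$. Let $\Lambda\in L^\infty(\Omega)^{2\times2}$ be symmetric with $\lambda_m|v|^2\le\Lambda(x)v\cdot v\le\lambda^M|v|^2$ for all $v\in\mathbb R^2$ and a.e. $x\in\Omega$, where $0<\lambda_m\le\lambda^M$. Let $\Delta t>0$. *Mesh.* Let $\mathfrak M$ be a finite partition of $\Omega$ (up to boundaries) into open polygons $K$ with centers $x_K\in K$. Edges (straight segments) meet only at vertices, and $\partial K\cap\partial L$ is exactly one edge whenever $K,L$ share an edge. Interior edges lie in $\Omega$ except possibly for their end points, and $\partial\Omega$ is the union of the boundary edges. The boundary edges form the set $\partial\mathfrak M$ of degenerate cells $L=\sigma$, whose center $x_L$ is the midpoint of $\sigma$; $\overline{\mathfrak M}=\mathfrak M\cup\partial\mathfrak M$. To each edge $\sigma$ belong its end points $x_{K^*},x_{L^*}$, its neighbors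 $K\in\mathfrak M$ and $L$ ($L\in\mathfrak M$ if $\sigma$ is interior, $L=\sigma\in\partial\mathfrak M$ otherwise), and the dual edge $\sigma^*=[x_K,x_L]$. If $\sigma$ is interior, the line through $\sigma$ strictly separates $x_K$ from $x_L$. The labels are chosen such that $(x_{L^*}-x_{K^*},\,x_L-x_K)$ is a direct basis. To each vertex $x_{K^*}$ is associated the dual cell $K^*$: the open polygon in $\Omega$ bounded by the dual edges of the edges ending at $x_{K^*}$ and, if $x_{K^*}\in\partial\Omega$, by the half boundary edges from $x_{K^*}$ to the midpoints of the boundary edges ending there. The set $\overline{\mathfrak M^*}$ of dual cells is a partition of $\Omega$ (up to boundaries), and dual edges meet only at their end points. The diamond $\mathcal D$ of $\sigma$ is the quadrilateral with diagonals $\sigma,\sigma^*$ (the union of the triangles with base $\sigma$ and apexes $x_K$, $x_L$; a single triangle if $\sigma\subset\partial\Omega$); the set $\mathfrak D$ of diamonds is a partition of $\Omega$ (up to boundaries). We write $\mathrm m_K,\mathrm m_{K^*},\mathrm m_{\mathcal D}$ for areas, $\mathrm m_\sigma,\mathrm m_{\sigma^*}$ for lengths, $n$ for the unit normal to $\sigma$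 pointing from $K$ to $L$, $n^*$ for the unit normal to $\sigma^*$ pointing from $K^*$ to $L^*$. *Discrete operators.* Let $\mathbb R^{\mathcal T}$ be the set of $u=((u_K)_{K\in\overline{\mathfrak M}},(u_{K^*})_{K^*\in\overline{\mathfrak M^*}})$; functions act on it componentwise. Put $$[\![v,u]\!]=\tfrac12\Big(\sum_{K\in\mathfrak M}\mathrm m_Ku_Kv_K+\sum_{K^*\in\overline{\mathfrak M^*}}\mathrm m_{K^*}u_{K^*}v_{K^*}\Big),\qquad \delta^{\mathcal D}u=\binom{u_K-u_L}{u_{K^*}-u_{L^*}},\qquad \Lambda^{\mathcal D}=\frac1{\mathrm m_{\mathcal D}}\int_{\mathcal D}\Lambda,$$ $$\mathbb A^{\mathcal D}=\frac1{4\mathrm m_{\mathcal D}}\begin{pmatrix}\mathrm m_\sigma^2\,\Lambda^{\mathcal D}n\cdot n&\mathrm m_\sigma\mathrm m_{\sigma^*}\,\Lambda^{\mathcal D}n\cdot n^*\\ \mathrm m_\sigma\mathrm m_{\sigma^*}\,\Lambda^{\mathcal D}n\cdot n^*&\mathrm m_{\sigma^*}^2\,\Lambda^{\mathcal D}n^*\cdot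 n^*\end{pmatrix},\qquad r^{\mathcal D}(u)=f\big(r(u_K,u_L),r(u_{K^*},u_{L^*})\big),$$ where $f(x,y)=\max(x,y)$ or $f(x,y)=\frac{x+y}2$, and $r:(0,\infty)^2\to(0,\infty)$ is nondecreasing in each variable, symmetric, satisfies $r(x,x)=x$ and $r(\lambda x,\lambda y)=\lambda r(x,y)$ for $\lambda>0$, and $\frac{x-y}{\log x-\log y}\le r(x,y)\le\max(x,y)$ for $x\ne y$. Put $$T_{\mathfrak D}(u;g,\psi)=\sum_{\mathcal D\in\mathfrak D}r^{\mathcal D}(u)\,\delta^{\mathcal D}g\cdot\mathbb A^{\mathcal D}\delta^{\mathcal D}\psi .$$ *Scheme.* Let $V_K=V(x_K)$, $V_{K^*}=V(x_{K^*})$, and let $u^0$ be given by $u^0_K=\frac1{\mathrm m_K}\int_Ku_0$ ($K\in\mathfrak M$), $u^0_{K^*}=\frac1{\mathrm m_{K^*}}\int_{K^*}u_0$, and $u^0_L=0$ for $L\in\partial\mathfrak M$. Given $u^n$, a solution of the nonlinear system is a vector $u^{n+1}\in(0,\infty)^{\mathcal T}$ with $$\Big[\!\Big[\frac{u^{n+1}-u^n}{\Delta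 t},\psi\Big]\!\Big]+T_{\mathfrak D}(u^{n+1};g^{n+1},\psi)=0\quad\text{for all }\psi\in\mathbb R^{\mathcal T},\qquad g^{n+1}=\log u^{n+1}+V_{\mathcal T}.\tag{S}$$ Define the steady state $u^\infty_K=\rho e^{-V_K}$, $u^\infty_{K^*}=\rho^*e^{-V_{K^*}}$ with $\rho=M^1\big(\sum_{K\in\mathfrak M}\mathrm m_Ke^{-V_K}\big)^{-1}$ and $\rho^*=M^1\big(\sum_{K^*\in\overline{\mathfrak M^*}}\mathrm m_{K^*}e^{-V_{K^*}}\big)^{-1}$, the entropy $\mathbb E_1^n=[\![u^\infty\Phi_1(u^n/u^\infty),1]\!]$ with $\Phi_1(s)=s\log s-s+1$ and $\Phi_1(0)=1$, and the dissipation $\mathbb I_1^{n+1}=T_{\mathfrak D}(u^{n+1};g^{n+1},g^{n+1})$. *Claim.* Let $n\ge0$, and let $u^1,\dots,u^n$ be solutions of the successive systems (S) starting from $u^0$. Then (S) has a solution $u^{n+1}\in(0,\infty)^{\mathcal T}$. Moreover, every such solution satisfies $$\frac{\mathbb E_1^{n+1}-\mathbb E_1^n}{\Delta t}+\mathbb I_1^{n+1}\le0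 .$$ -/

import Mathlib

open MeasureTheory Matrix

noncomputable section

/-- The Euclidean plane `ℝ²`. -/
abbrev Plane : Type := EuclideanSpace ℝ (Fin 2)

/-- The determinant of the pair of plane vectors `(a, b)`. -/
def cross (a b : Plane) : ℝ := a 0 * b 1 - a 1 * b 0

/-- `P` is an open polygon with boundary `S`: a bounded connected open set whose topological
boundary is `S` (below, `S` is always a finite union of segments). -/
structure IsOpenPolygon (P S : Set Plane) : Prop where
  isOpen : IsOpen P
  isConnected : IsConnected P
  isBounded : Bornology.IsBounded P
  frontier_eq : frontier P = S

/-- A polygonal domain: a bounded connected open set whose boundary is a finite union of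
nondegenerate segments. -/
def IsPolygonalDomain (Ω : Set Plane) : Prop :=
  ∃ s : Finset (Plane × Plane), (∀ p ∈ s, p.1 ≠ p.2) ∧
    IsOpenPolygon Ω (⋃ p ∈ s, segment ℝ p.1 p.2)

/-- The combinatorial and geometric data of a DDFV mesh. The index types are
* `C`: interior primal cells,
* `V`: vertices of the primal mesh, which are also the indices of the dual cells,
* `I`: interior primal edges,
* `B`: boundary primal edges, which are also the indices of the degenerate boundary primal cells.

The edge `e` is `σ = K|L`, with end points `x_{K*}` and `x_{L*}`, where `K = left e`,
`K* = src e`, `L* = tgt e`, while `L = right e` if `e` is interior and `L` is the edge itself,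
seen as a degenerate cell, if `e` is a boundary edge. Edges are in bijection with diamonds and
with dual edges. -/
structure MeshData (C V I B : Type*) where
  cell : C → Set Plane
  center : C → Plane
  vertex : V → Plane
  dualCell : V → Set Plane
  left : I ⊕ B → C
  right : I → C
  src : I ⊕ B → V
  tgt : I ⊕ B → V

namespace MeshData

variable {C V I B : Type*} (M : MeshData C V I B)

/-- The middle of a boundary edge. -/
def bdMid (b : B) : Plane := midpoint ℝ (M.vertex (M.src (.inr b))) (M.vertex (M.tgt (.inr b)))

/-- The center `x_K` of a primal cell, interior or degenerate. -/
def primalCenter : C ⊕ B → Plane := Sum.elim M.center M.bdMid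

/-- The first primal cell `K` of a diamond. -/
def primK (e : I ⊕ B) : C ⊕ B := .inl (M.left e)

/-- The second primal cell `L` of a diamond. -/
def primL : I ⊕ B → C ⊕ B := Sum.elim (fun i => .inl (M.right i)) .inr

/-- The primal edge `σ`. -/
def edge (e : I ⊕ B) : Set Plane := segment ℝ (M.vertex (M.src e)) (M.vertex (M.tgt e))

/-- The primal edge without its end points. -/
def openEdge (e : I ⊕ B) : Set Plane :=
  openSegment ℝ (M.vertex (M.src e)) (M.vertex (M.tgt e))

/-- The dual edge `σ*`, which joins `x_K` to `x_L`. -/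
def dualEdge (e : I ⊕ B) : Set Plane :=
  segment ℝ (M.primalCenter (M.primK e)) (M.primalCenter (M.primL e))

/-- The dual edge without its end points. -/
def openDualEdge (e : I ⊕ B) : Set Plane :=
  openSegment ℝ (M.primalCenter (M.primK e)) (M.primalCenter (M.primL e))

/-- `σ` is an edge of the interior primal cell `K`. -/
def IsEdgeOf (e : I ⊕ B) (K : C) : Prop := M.primK e = .inl K ∨ M.primL e = .inl K

/-- The vertex `v` is an end point of `σ`. -/
def IsEndOf (v : V) (e : I ⊕ B) : Prop := M.src e = v ∨ M.tgt e = v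

/-- The (closed) diamond with diagonals `σ` and `σ*`: the quadrilateral made of the two triangles
with common side `σ` and apexes `x_K` and `x_L`; the second triangle degenerates into `σ` if `σ`
is a boundary edge. -/
def diamond (e : I ⊕ B) : Set Plane :=
  convexHull ℝ {M.primalCenter (M.primK e), M.vertex (M.src e), M.vertex (M.tgt e)} ∪
    convexHull ℝ {M.primalCenter (M.primL e), M.vertex (M.src e), M.vertex (M.tgt e)}

/-- `M` is a DDFV mesh of `Ω`. -/
structure IsDDFVMesh (Ω : Set Plane) : Prop where
  vertex_injective : Function.Injective M.vertex
  /-- Each interior primal cell is an open polygon, bounded by its edges. -/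
  cell_polygon : ∀ K, IsOpenPolygon (M.cell K) (⋃ (e) (_ : M.IsEdgeOf e K), M.edge e)
  center_mem : ∀ K, M.center K ∈ M.cell K
  /-- The interior primal cells form a partition of `Ω` (up to their boundaries). -/
  cell_subset : ∀ K, M.cell K ⊆ Ω
  cell_disjoint : Pairwise fun K L => Disjoint (M.cell K) (M.cell L)
  cell_cover : Ω ⊆ ⋃ K, closure (M.cell K)
  /-- Edges meet only at vertices. -/
  edge_disjoint : Pairwise fun e e' => Disjoint (M.openEdge e) (M.edge e')
  /-- Two neighboring cells have exactly one edge in common, which lies in `Ω`. -/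
  left_ne_right : ∀ i, M.left (.inl i) ≠ M.right i
  frontier_inter : ∀ i, frontier (M.cell (M.left (.inl i))) ∩ frontier (M.cell (M.right i)) =
    M.edge (.inl i)
  openEdge_subset : ∀ i, M.openEdge (.inl i) ⊆ Ω
  /-- The boundary edges cover exactly the boundary of `Ω`. -/
  frontier_eq : frontier Ω = ⋃ b, M.edge (.inr b)
  /-- The straight line through `σ` separates `x_K` from `x_L` (from the outside of `Ω`, if `σ` is
  a boundary edge), and `K`, `L`, `K*`, `L*` are labelled in such a way that the basis
  `(x_{L*} - x_{K*}, x_L - x_K)` is direct. -/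
  orient_left : ∀ e, cross (M.vertex (M.tgt e) - M.vertex (M.src e))
    (M.center (M.left e) - M.vertex (M.src e)) < 0
  orient_right : ∀ i, 0 < cross (M.vertex (M.tgt (.inl i)) - M.vertex (M.src (.inl i)))
    (M.center (M.right i) - M.vertex (M.src (.inl i)))
  /-- The dual cell of a vertex is the open polygon bounded by the dual edges which connect the
  centers of the primal cells around this vertex and, if the vertex is on the boundary of `Ω`, by
  the halves of boundary edges between this vertex and the middles of these edges. -/
  dual_polygon : ∀ v, IsOpenPolygon (M.dualCell v)
    ((⋃ (e) (_ : M.IsEndOf v e), M.dualEdge e) ∪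
      ⋃ (b) (_ : M.IsEndOf v (.inr b)), segment ℝ (M.vertex v) (M.bdMid b))
  /-- The dual cells form a partition of `Ω` (up to their boundaries). -/
  dual_subset : ∀ v, M.dualCell v ⊆ Ω
  dual_disjoint : Pairwise fun v w => Disjoint (M.dualCell v) (M.dualCell w)
  dual_cover : Ω ⊆ ⋃ v, closure (M.dualCell v)
  /-- Dual edges meet only at centers. -/
  dualEdge_disjoint : Pairwise fun e e' => Disjoint (M.openDualEdge e) (M.dualEdge e')
  /-- The diamonds form a partition of `Ω` (up to their boundaries). -/
  diamond_disjoint : Pairwise fun e e' =>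
    Disjoint (interior (M.diamond e)) (interior (M.diamond e'))
  diamond_cover : ⋃ e, M.diamond e = closure Ω

/-! ### Measures and normals -/

/-- `m_K`, for an interior primal cell. -/
def mCell (K : C) : ℝ := volume.real (M.cell K)

/-- `m_{K*}`. -/
def mDual (v : V) : ℝ := volume.real (M.dualCell v)

/-- `m_D`. -/
def mDiamond (e : I ⊕ B) : ℝ := volume.real (M.diamond e)

/-- `m_σ`, the length of the primal edge. -/
def mEdge (e : I ⊕ B) : ℝ := dist (M.vertex (M.src e)) (M.vertex (M.tgt e))

/-- `m_{σ*}`, the length of the dual edge. -/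
def mDualEdge (e : I ⊕ B) : ℝ :=
  dist (M.primalCenter (M.primK e)) (M.primalCenter (M.primL e))

/-- The unit normal to `σ`, outward `K`: the basis `(τ, n)` is direct, where `τ` is the unit
vector from `x_{K*}` to `x_{L*}`. -/
def normal (e : I ⊕ B) : Fin 2 → ℝ :=
  let t := M.vertex (M.tgt e) - M.vertex (M.src e)
  ![-(t 1) / M.mEdge e, t 0 / M.mEdge e]

/-- The unit normal to `σ*`, outward `K*`: the basis `(n*, τ*)` is direct, where `τ*` is the unit
vector from `x_K` to `x_L`. -/
def dualNormal (e : I ⊕ B) : Fin 2 → ℝ :=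
  let t := M.primalCenter (M.primL e) - M.primalCenter (M.primK e)
  ![t 1 / M.mDualEdge e, -(t 0) / M.mDualEdge e]

/-! ### Discrete unknowns and discrete operators

`ℝ^𝒯` is the space of functions on `(C ⊕ B) ⊕ V`: one value for each interior primal cell, each
boundary edge and each dual cell. -/

/-- The nodal values of a function. -/
def nodal (W : Plane → ℝ) : (C ⊕ B) ⊕ V → ℝ :=
  Sum.elim (fun K => W (M.primalCenter K)) (fun v => W (M.vertex v))

/-- The semi-definite bilinear form `⟦·,·⟧` on `ℝ^𝒯`; boundary primal cells have measure zero. -/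
def bracket [Fintype C] [Fintype V] (v u : (C ⊕ B) ⊕ V → ℝ) : ℝ :=
  (1 / 2) * (∑ K : C, M.mCell K * u (.inl (.inl K)) * v (.inl (.inl K)) +
    ∑ w : V, M.mDual w * u (.inr w) * v (.inr w))

/-- `δ^D u = (u_K - u_L, u_{K*} - u_{L*})`. -/
def delta (u : (C ⊕ B) ⊕ V → ℝ) (e : I ⊕ B) : Fin 2 → ℝ :=
  ![u (.inl (M.primK e)) - u (.inl (M.primL e)), u (.inr (M.src e)) - u (.inr (M.tgt e))]

/-- The mean value `Λ^D` of the anisotropy tensor on a diamond. -/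
def meanTensor (Λ : Plane → Matrix (Fin 2) (Fin 2) ℝ) (e : I ⊕ B) : Matrix (Fin 2) (Fin 2) ℝ :=
  Matrix.of fun i j => (1 / M.mDiamond e) * ∫ x in M.diamond e, Λ x i j

/-- The local matrix `𝔸^D`. -/
def localMatrix (Λ : Plane → Matrix (Fin 2) (Fin 2) ℝ) (e : I ⊕ B) :
    Matrix (Fin 2) (Fin 2) ℝ :=
  let c := 1 / (4 * M.mDiamond e)
  let offDiag := c * (M.mEdge e * M.mDualEdge e) *
    ((M.meanTensor Λ e *ᵥ M.normal e) ⬝ᵥ M.dualNormal e)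
  !![c * M.mEdge e ^ 2 * ((M.meanTensor Λ e *ᵥ M.normal e) ⬝ᵥ M.normal e), offDiag;
    offDiag, c * M.mDualEdge e ^ 2 * ((M.meanTensor Λ e *ᵥ M.dualNormal e) ⬝ᵥ M.dualNormal e)]

/-- The reconstruction `r^D(u) = f(r(u_K, u_L), r(u_{K*}, u_{L*}))` on a diamond. -/
def recon (f r : ℝ → ℝ → ℝ) (u : (C ⊕ B) ⊕ V → ℝ) (e : I ⊕ B) : ℝ :=
  f (r (u (.inl (M.primK e))) (u (.inl (M.primL e)))) (r (u (.inr (M.src e))) (u (.inr (M.tgt e))))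

/-- The form `T_𝔇(u; g, ψ)`. -/
def diffusion [Fintype I] [Fintype B] (Λ : Plane → Matrix (Fin 2) (Fin 2) ℝ) (f r : ℝ → ℝ → ℝ)
    (u g ψ : (C ⊕ B) ⊕ V → ℝ) : ℝ :=
  ∑ e : I ⊕ B, M.recon f r u e * (M.delta g e ⬝ᵥ (M.localMatrix Λ e *ᵥ M.delta ψ e))

/-- The discrete potential `g = log u + W_𝒯`, where `W` is the exterior potential. -/
def potential (W : Plane → ℝ) (u : (C ⊕ B) ⊕ V → ℝ) : (C ⊕ B) ⊕ V → ℝ :=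
  fun i => Real.log (u i) + M.nodal W i

/-! ### The scheme -/

/-- The discrete initial condition: mean values of `u₀` on the interior primal cells and on the
dual cells, zero on the boundary edges. -/
def initial (u₀ : Plane → ℝ) : (C ⊕ B) ⊕ V → ℝ :=
  Sum.elim (Sum.elim (fun K => (1 / M.mCell K) * ∫ x in M.cell K, u₀ x) (fun _ => 0))
    (fun v => (1 / M.mDual v) * ∫ x in M.dualCell v, u₀ x)

/-- One step of the scheme: `w ∈ (0,∞)^𝒯` is a solution `u^{n+1}` of the nonlinear system, given
`u = u^n`. -/
def IsStep [Fintype C] [Fintype V] [Fintype I] [Fintype B] (W : Plane → ℝ)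
    (Λ : Plane → Matrix (Fin 2) (Fin 2) ℝ) (f r : ℝ → ℝ → ℝ) (Δt : ℝ)
    (u w : (C ⊕ B) ⊕ V → ℝ) : Prop :=
  (∀ i, 0 < w i) ∧ ∀ ψ : (C ⊕ B) ⊕ V → ℝ,
    M.bracket (fun i => (w i - u i) / Δt) ψ + M.diffusion Λ f r w (M.potential W w) ψ = 0

/-! ### Steady state, entropy and dissipation -/

/-- The steady state of mass `m`: `ρ e^{-W}` on the primal mesh and `ρ* e^{-W}` on the dual mesh,
each of total mass `m`. (The values on the boundary edges do not enter the entropy.) -/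
def steady [Fintype C] [Fintype V] (W : Plane → ℝ) (m : ℝ) : (C ⊕ B) ⊕ V → ℝ :=
  Sum.elim
    (fun K => m * (∑ L : C, M.mCell L * Real.exp (-W (M.center L)))⁻¹ *
      Real.exp (-W (M.primalCenter K)))
    (fun v => m * (∑ w : V, M.mDual w * Real.exp (-W (M.vertex w)))⁻¹ *
      Real.exp (-W (M.vertex v)))

/-- The relative entropy `𝔼₁ = ⟦u^∞ Φ₁(u / u^∞), 1⟧` with `Φ₁(s) = s log s - s + 1`, where `u^∞` is
the steady state of mass `m`. -/
def entropy [Fintype C] [Fintype V] (W : Plane → ℝ) (m : ℝ) (u : (C ⊕ B) ⊕ V → ℝ) : ℝ :=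
  M.bracket (fun i =>
    let s := u i / M.steady W m i
    M.steady W m i * (s * Real.log s - s + 1)) (fun _ => 1)

/-- The entropy dissipation `𝕀₁ = T_𝔇(u; g, g)`. -/
def dissipation [Fintype I] [Fintype B] (W : Plane → ℝ) (Λ : Plane → Matrix (Fin 2) (Fin 2) ℝ)
    (f r : ℝ → ℝ → ℝ) (u : (C ⊕ B) ⊕ V → ℝ) : ℝ :=
  M.diffusion Λ f r u (M.potential W u) (M.potential W u)

end MeshData

/-- The properties of the mean function `r : (0,∞)² → (0,∞)`. -/
structure IsMeanFunction (r : ℝ → ℝ → ℝ) : Prop where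
  pos : ∀ x y, 0 < x → 0 < y → 0 < r x y
  mono_left : ∀ x x' y, 0 < x → x ≤ x' → 0 < y → r x y ≤ r x' y
  mono_right : ∀ x y y', 0 < x → 0 < y → y ≤ y' → r x y ≤ r x y'
  diag : ∀ x, 0 < x → r x x = x
  symm : ∀ x y, 0 < x → 0 < y → r x y = r y x
  homog : ∀ a x y, 0 < a → 0 < x → 0 < y → r (a * x) (a * y) = a * r x y
  lower : ∀ x y, 0 < x → 0 < y → x ≠ y → (x - y) / (Real.log x - Real.log y) ≤ r x y
  upper : ∀ x y, 0 < x → 0 < y → x ≠ y → r x y ≤ max x y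

/-- `Λ` is (on `Ω`) bounded, symmetric and uniformly elliptic, with constants `lm ≤ lM`. -/
structure IsEllipticTensor (Ω : Set Plane) (Λ : Plane → Matrix (Fin 2) (Fin 2) ℝ)
    (lm lM : ℝ) : Prop where
  memLp : ∀ i j, MemLp (fun x => Λ x i j) ⊤ (volume.restrict Ω)
  symm : ∀ᵐ x ∂volume.restrict Ω, (Λ x).IsSymm
  pos : 0 < lm
  le : lm ≤ lM
  lower : ∀ᵐ x ∂volume.restrict Ω, ∀ v : Fin 2 → ℝ, lm * (v ⬝ᵥ v) ≤ (Λ x *ᵥ v) ⬝ᵥ v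
  upper : ∀ᵐ x ∂volume.restrict Ω, ∀ v : Fin 2 → ℝ, (Λ x *ᵥ v) ⬝ᵥ v ≤ lM * (v ⬝ᵥ v)

end

/-!
The nonlinear system is solved for the discrete potential `x = log u + V_𝒯`, so that positivity of
the solution is automatic. Tested with a vector `ψ`, the system is a linear form
(`MeshData.residual`) which depends continuously on `x`, because a monotone and homogeneous mean
function is continuous (`IsMeanFunction.continuousOn`). It has a zero by Brouwer's theorem, in the
form of `exists_eq_zero_of_inner_pos`, once the residual tested with `x` itself is known to be
positive for large `x`. That residual is a sum of terms which are bounded from below. If it is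
nonpositive, each term is therefore bounded (`MeshData.exists_bound_of_residual_nonpos`):

* the terms in time bound `x` at the cells on which the previous values are positive;
* the diffusion terms are bounded from below by multiples of `r(u_K, u_L) (x_K - x_L)²` and
  `r(u_{K*}, u_{L*}) (x_{K*} - x_{L*})²`, since the local matrices are coercive
  (`MeshData.IsDDFVMesh.exists_localMatrix_coercive`). As `r` dominates the logarithmic mean, such a
  bound carries a bound on `x` from one end of an edge to the other
  (`IsMeanFunction.abs_log_sub_log_le`);
* the adjacency graphs of the primal and of the dual mesh are connected
  (`MeshData.IsDDFVMesh.forall_of_propagates`), because a connected open set of the plane remains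
  connected when a finite set, here the vertices or the centers, is removed.

Brouwer's theorem is proved by the analytic argument of Milnor and Rogers. If `f` is a `C¹`
retraction of a ball onto its sphere, then `(1 - t) id + t f` is a bijection of the ball for small
`t`. The integral over the ball of its Jacobian determinant, a polynomial in `t`, is thus the volume
of the ball for small `t`, hence for `t = 1`, where it should vanish.

The entropy inequality follows from the convexity of `Φ₁` by testing the scheme with the potential
(`MeshData.IsStep.entropy_dissipation`). The logarithms of `ρ` and `ρ*` do not contribute, since mass
is conserved on each of the two meshes.
-/

/-! ### Brouwer's theorem -/

section Brouwer

open Set Metric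

variable {E : Type*} [NormedAddCommGroup E] [InnerProductSpace ℝ E]

/-- A map which is Lipschitz on a closed ball and vanishes on its boundary sphere remains Lipschitz
when it is extended by zero. -/
lemma LipschitzOnWith.lipschitzWith_indicator_closedBall {K : NNReal} {R : ℝ} {g : E → E}
    (hg : LipschitzOnWith K g (closedBall 0 R)) (h0 : ∀ x ∈ sphere (0 : E) R, g x = 0) :
    LipschitzWith K ((closedBall (0 : E) R).indicator g) := by
  have key : ∀ x ∈ closedBall (0 : E) R, ∀ y ∉ closedBall (0 : E) R, ‖g x‖ ≤ K * ‖x - y‖ := by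
    intro x hx y hy
    -- the segment from `x` to `y` crosses the sphere
    have hcont : ContinuousOn (fun t : ℝ => ‖AffineMap.lineMap x y t‖) (Icc 0 1) :=
      (AffineMap.lineMap_continuous.norm).continuousOn
    have hR : R ∈ Icc ‖AffineMap.lineMap x y (0 : ℝ)‖ ‖AffineMap.lineMap x y (1 : ℝ)‖ := by
      simp only [mem_closedBall, dist_zero_right, not_le] at hx hy
      simpa using ⟨hx, hy.le⟩
    obtain ⟨t, ht, htR⟩ := intermediate_value_Icc zero_le_one hcont hR
    set z := AffineMap.lineMap x y t
    have hz : z ∈ sphere (0 : E) R := by simpa using htR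
    have h1 := hg.dist_le_mul x hx z (sphere_subset_closedBall hz)
    rw [h0 z hz, dist_zero_right] at h1
    refine h1.trans (mul_le_mul_of_nonneg_left ?_ K.2)
    rw [dist_comm, dist_lineMap_left, dist_eq_norm, Real.norm_of_nonneg ht.1]
    exact mul_le_of_le_one_left (norm_nonneg _) ht.2
  refine LipschitzWith.of_dist_le_mul fun x y => ?_
  rw [dist_eq_norm, dist_eq_norm]
  by_cases hx : x ∈ closedBall (0 : E) R <;> by_cases hy : y ∈ closedBall (0 : E) R
  · rw [indicator_of_mem hx, indicator_of_mem hy, ← dist_eq_norm, ← dist_eq_norm]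
    exact hg.dist_le_mul x hx y hy
  · rw [indicator_of_mem hx, indicator_of_notMem hy, sub_zero]
    exact key x hx y hy
  · rw [indicator_of_notMem hx, indicator_of_mem hy, zero_sub, norm_neg, norm_sub_rev]
    exact key y hy x hx
  · rw [indicator_of_notMem hx, indicator_of_notMem hy, sub_zero, norm_zero]
    positivity

variable [FiniteDimensional ℝ E]

/-- As a function of `t`, the determinant `det (1 + t A)` is a polynomial of degree at most `dim E`.
Its value at `1` is therefore a fixed linear combination of its values at small positive `t`. -/
lemma exists_det_interpolation (E : Type*) [NormedAddCommGroup E] [InnerProductSpace ℝ E]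
    [FiniteDimensional ℝ E] {δ : ℝ} (hδ : 0 < δ) :
    ∃ (s : Finset ℝ) (c : ℝ → ℝ), (∀ t ∈ s, 0 < t ∧ t < δ) ∧ ∑ t ∈ s, c t = 1 ∧
      ∀ A : E →L[ℝ] E, ((1 : E →L[ℝ] E) + A).det =
        ∑ t ∈ s, c t * ((1 : E →L[ℝ] E) + t • A).det := by
  classical
  set d := Module.finrank ℝ E
  set s : Finset ℝ := (Finset.range (d + 1)).image fun k : ℕ => δ / (k + 2)
  have hs : s.card = d + 1 := by
    rw [Finset.card_image_of_injective, Finset.card_range]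
    intro a b hab
    have : (a : ℝ) + 2 = b + 2 := by
      have h1 : (a : ℝ) + 2 ≠ 0 := by positivity
      have h2 : (b : ℝ) + 2 ≠ 0 := by positivity
      field_simp at hab
      linarith
    exact_mod_cast (add_right_cancel this)
  have hinj : Set.InjOn (id : ℝ → ℝ) s := Set.injOn_id _
  refine ⟨s, fun t => (Lagrange.basis s id t).eval 1, ?_, ?_, ?_⟩
  · intro t ht
    obtain ⟨k, -, rfl⟩ := Finset.mem_image.1 ht
    refine ⟨by positivity, div_lt_self hδ ?_⟩
    have : (0 : ℝ) ≤ k := Nat.cast_nonneg k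
    linarith
  · have := congrArg (Polynomial.eval 1)
      (Lagrange.sum_basis hinj (Finset.card_pos.1 (by omega : 0 < s.card)))
    simpa [Polynomial.eval_finsetSum] using this
  · intro A
    let b := Module.finBasis ℝ E
    set N : Matrix (Fin d) (Fin d) ℝ := LinearMap.toMatrix b b (A : E →ₗ[ℝ] E)
    set P : Polynomial ℝ := det ((Polynomial.X : Polynomial ℝ) • N.map Polynomial.C +
      (1 : Matrix (Fin d) (Fin d) ℝ).map Polynomial.C)
    have hP : ∀ t : ℝ, P.eval t = ((1 : E →L[ℝ] E) + t • A).det := by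
      intro t
      have hN : LinearMap.toMatrix b b (((1 : E →L[ℝ] E) + t • A : E →L[ℝ] E) : E →ₗ[ℝ] E) =
          t • N + 1 := by
        rw [add_comm]
        simp [N, ContinuousLinearMap.toLinearMap_add]
      rw [ContinuousLinearMap.det, ← LinearMap.det_toMatrix b, hN, ← Polynomial.coe_evalRingHom,
        RingHom.map_det]
      congr 1
      ext i j
      simp [Matrix.one_apply, apply_ite (Polynomial.eval t), mul_comm t]
    have hdeg : P.degree < s.card := by
      refine lt_of_le_of_lt Polynomial.degree_le_natDegree ?_
      have := Polynomial.natDegree_det_X_add_C_le N 1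
      rw [Fintype.card_fin] at this
      rw [hs]
      exact_mod_cast Nat.lt_succ_of_le this
    have h := congrArg (Polynomial.eval 1) (Lagrange.eq_interpolate hinj hdeg)
    rw [hP, one_smul, Lagrange.interpolate_apply, Polynomial.eval_finsetSum] at h
    rw [h]
    refine Finset.sum_congr rfl fun t _ => ?_
    rw [Polynomial.eval_mul, Polynomial.eval_C, id, hP, mul_comm]

/-- If `g` is Lipschitz on a closed ball and vanishes on its boundary sphere, then, for small `t`,
the perturbation `x ↦ x + t g x` of the identity is a bijection of the ball onto itself. -/
lemma LipschitzOnWith.bijOn_add_smul_closedBall {K : NNReal} {R t : ℝ} {g : E → E}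
    (hg : LipschitzOnWith K g (closedBall 0 R)) (h0 : ∀ x ∈ sphere (0 : E) R, g x = 0)
    (ht : 0 ≤ t) (htK : t * K < 1)
    (hmaps : MapsTo (fun x => x + t • g x) (closedBall 0 R) (closedBall 0 R)) :
    BijOn (fun x => x + t • g x) (closedBall 0 R) (closedBall 0 R) := by
  refine ⟨hmaps, ?_, ?_⟩
  · intro x hx y hy hxy
    have h1 : x - y = t • (g y - g x) := by
      have : x + t • g x = y + t • g y := hxy
      rw [smul_sub, sub_eq_sub_iff_add_eq_add, this, add_comm]
    have h2 := hg.dist_le_mul y hy x hx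
    rw [dist_eq_norm, dist_comm, dist_eq_norm] at h2
    have h3 : ‖x - y‖ ≤ t * K * ‖x - y‖ := by
      calc ‖x - y‖ = t * ‖g y - g x‖ := by
            conv_lhs => rw [h1, norm_smul, Real.norm_of_nonneg ht]
        _ ≤ t * (K * ‖x - y‖) := by gcongr
        _ = _ := by ring
    have : ‖x - y‖ = 0 := by
      by_contra hne
      have hpos : 0 < ‖x - y‖ := lt_of_le_of_ne (norm_nonneg _) (Ne.symm hne)
      nlinarith
    exact sub_eq_zero.1 (norm_eq_zero.1 this)
  · intro y hy
    set h := (closedBall (0 : E) R).indicator g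
    have hL := hg.lipschitzWith_indicator_closedBall h0
    have hc : ContractingWith (t.toNNReal * K) (fun x => y - t • h x) := by
      refine ⟨?_, LipschitzWith.of_dist_le_mul fun a b => ?_⟩
      · rw [← NNReal.coe_lt_coe]
        simpa [Real.coe_toNNReal _ ht] using htK
      · have := hL.dist_le_mul b a
        rw [dist_comm b a, dist_eq_norm] at this
        rw [dist_eq_norm, NNReal.coe_mul, Real.coe_toNNReal _ ht, sub_sub_sub_cancel_left,
          ← smul_sub, norm_smul, Real.norm_of_nonneg ht, mul_assoc]
        gcongr
    obtain ⟨x, hx, -⟩ := hc.exists_fixedPoint y (edist_ne_top _ _)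
    have hx' : x + t • h x = y := by
      have : y - t • h x = x := hx
      exact (sub_eq_iff_eq_add.1 this).symm
    have hxB : x ∈ closedBall (0 : E) R := by
      by_contra hxB
      have : x = y := by simpa [h, indicator_of_notMem hxB] using hx'
      exact hxB (this ▸ hy)
    exact ⟨x, hxB, by simpa [h, indicator_of_mem hxB] using hx'⟩

/-- There is no `C¹` retraction of a ball onto its boundary sphere. -/
theorem not_exists_contDiff_retraction {R : ℝ} (hR : 0 < R) {f : E → E} (hf : ContDiff ℝ 1 f)
    (hfix : ∀ x ∈ sphere (0 : E) R, f x = x)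
    (hnorm : ∀ x, ‖f x‖ = R) : False := by
  borelize E
  set B := closedBall (0 : E) R
  set μ : Measure E := volume
  set g : E → E := fun x => f x - x
  have hg : ContDiff ℝ 1 g := hf.sub contDiff_id
  have hg0 : ∀ x ∈ sphere (0 : E) R, g x = 0 := fun x hx => sub_eq_zero.2 (hfix x hx)
  have hDcont : Continuous (fderiv ℝ g) := hg.continuous_fderiv one_ne_zero
  have hgd : ∀ x, HasFDerivAt g (fderiv ℝ g x) x := fun x =>
    (hg.differentiable one_ne_zero x).hasFDerivAt
  obtain ⟨K, hK⟩ : ∃ K : NNReal, ∀ x ∈ B, ‖fderiv ℝ g x‖ ≤ K := by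
    obtain ⟨C, hC⟩ := (isCompact_closedBall (0 : E) R).exists_bound_of_continuousOn
      hDcont.continuousOn
    exact ⟨C.toNNReal, fun x hx => (hC x hx).trans (Real.le_coe_toNNReal C)⟩
  have hL : LipschitzOnWith K g B :=
    (convex_closedBall (0 : E) R).lipschitzOnWith_of_nnnorm_fderiv_le
      (fun x _ => (hgd x).differentiableAt) (fun x hx => hK x hx)
  -- close to the identity, determinants are positive
  obtain ⟨ε, hε, hdet⟩ : ∃ ε > 0, ∀ A : E →L[ℝ] E, ‖A‖ < ε →
      0 < ((1 : E →L[ℝ] E) + A).det := by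
    have hc : Continuous fun A : E →L[ℝ] E => ((1 : E →L[ℝ] E) + A).det :=
      ContinuousLinearMap.continuous_det.comp (continuous_const.add continuous_id)
    have h1 : (0 : ℝ) < ((1 : E →L[ℝ] E) + 0).det := by
      simp [ContinuousLinearMap.det]
    obtain ⟨ε, hε, h⟩ := Metric.eventually_nhds_iff.1 (hc.continuousAt.eventually (lt_mem_nhds h1))
    exact ⟨ε, hε, fun A hA => h (by simpa using hA)⟩
  set δ : ℝ := min 1 (min 1 ε / (K + 1))
  have hK1 : (0 : ℝ) < K + 1 := by positivity
  have hδ : 0 < δ := by positivity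
  obtain ⟨s, c, hs, hc1, hsum⟩ := exists_det_interpolation E hδ
  have hint : ∀ t : ℝ, IntegrableOn (fun x => ((1 : E →L[ℝ] E) + t • fderiv ℝ g x).det) B μ := by
    intro t
    exact (ContinuousLinearMap.continuous_det.comp
      (continuous_const.add (hDcont.const_smul t))).continuousOn.integrableOn_compact
      (isCompact_closedBall _ _)
  have hvol : ∀ t ∈ s, ∫ x in B, ((1 : E →L[ℝ] E) + t • fderiv ℝ g x).det ∂μ = μ.real B := by
    intro t hts
    obtain ⟨ht0, htδ⟩ := hs t hts
    have ht1 : t < 1 := htδ.trans_le (min_le_left _ _)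
    have ht2 : t * (K + 1) < min 1 ε := (lt_div_iff₀ hK1).1 (htδ.trans_le (min_le_right _ _))
    have hpos : ∀ x ∈ B, 0 < ((1 : E →L[ℝ] E) + t • fderiv ℝ g x).det := by
      intro x hx
      refine hdet _ ?_
      rw [norm_smul, Real.norm_of_nonneg ht0.le]
      calc t * ‖fderiv ℝ g x‖ ≤ t * (K + 1) := by
            gcongr; exact (hK x hx).trans (by linarith)
        _ < ε := ht2.trans_le (min_le_right _ _)
    have hbij := hL.bijOn_add_smul_closedBall hg0 ht0.le
      (by nlinarith [ht2.trans_le (min_le_left 1 ε)]) (by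
        intro x hx
        have hx' : ‖x‖ ≤ R := by simpa [B] using hx
        have : x + t • g x = (1 - t) • x + t • f x := by
          simp only [g]; module
        simp only [mem_closedBall, dist_zero_right, this]
        calc ‖(1 - t) • x + t • f x‖ ≤ ‖(1 - t) • x‖ + ‖t • f x‖ := norm_add_le _ _
          _ = (1 - t) * ‖x‖ + t * R := by
            rw [norm_smul, norm_smul, Real.norm_of_nonneg ht0.le,
              Real.norm_of_nonneg (by linarith), hnorm]
          _ ≤ R := by nlinarith)
    have hcv := lintegral_abs_det_fderiv_eq_addHaar_image μ
      (isClosed_closedBall (x := (0 : E)) (ε := R)).measurableSet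
      (f := fun x => x + t • g x) (f' := fun x => (1 : E →L[ℝ] E) + t • fderiv ℝ g x)
      (fun x _ => ((hasFDerivAt_id x).add ((hgd x).const_smul t)).hasFDerivWithinAt) hbij.injOn
    rw [hbij.image_eq] at hcv
    rw [integral_eq_lintegral_of_nonneg_ae, Measure.real, ← hcv]
    · congr 1
      refine setLIntegral_congr_fun measurableSet_closedBall fun x hx => ?_
      rw [abs_of_pos (hpos x hx)]
    · exact (ae_restrict_iff' measurableSet_closedBall).2 (.of_forall fun x hx => (hpos x hx).le)
    · exact (hint t).aestronglyMeasurable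
  -- `‖f‖` is constant, so that the range of the derivative of `f` is orthogonal to `f`
  have hzero : ∀ x, ((1 : E →L[ℝ] E) + fderiv ℝ g x).det = 0 := by
    intro x
    have hfd : HasFDerivAt f ((1 : E →L[ℝ] E) + fderiv ℝ g x) x := by
      have := (hasFDerivAt_id x).add (hgd x)
      refine this.congr_of_eventuallyEq (.of_forall fun y => ?_)
      simp [g]
    set A := (1 : E →L[ℝ] E) + fderiv ℝ g x
    have horth : ∀ v, inner ℝ (f x) (A v) = 0 := by
      intro v
      have h1 := hfd.norm_sq
      have h2 : HasFDerivAt (fun y => ‖f y‖ ^ 2) (0 : E →L[ℝ] ℝ) x := by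
        simp only [hnorm]; exact hasFDerivAt_const _ _
      have := congrArg (fun L : E →L[ℝ] ℝ => L v) (h1.unique h2)
      simpa using this
    by_contra hne
    have hA : IsUnit (LinearMap.det (A : E →ₗ[ℝ] E)) := isUnit_iff_ne_zero.2 hne
    have hsurj : Function.Surjective (A : E →ₗ[ℝ] E) :=
      ((Module.End.isUnit_iff _).1 ((LinearMap.isUnit_iff_isUnit_det _).2 hA)).2
    obtain ⟨v, hv⟩ := hsurj (f x)
    have := horth v
    rw [show A v = f x from hv, real_inner_self_eq_norm_sq, hnorm] at this
    nlinarith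
  have hfinal : ∫ x in B, ((1 : E →L[ℝ] E) + fderiv ℝ g x).det ∂μ = μ.real B := by
    simp only [fun x => hsum (fderiv ℝ g x)]
    rw [integral_finsetSum _ fun t _ => (hint t).const_mul _]
    simp_rw [integral_const_mul]
    rw [Finset.sum_congr rfl fun t ht => by rw [hvol t ht], ← Finset.sum_mul, hc1, one_mul]
  simp only [hzero, integral_zero] at hfinal
  have : 0 < μ.real B := ENNReal.toReal_pos
    (measure_closedBall_pos μ 0 hR).ne' measure_closedBall_lt_top.ne
  linarith

/-- A continuous vector field which points outwards far from the origin has a zero. -/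
theorem exists_eq_zero_of_inner_pos {F : E → E} (hF : Continuous F) {R : ℝ} (hR : 0 < R)
    (hpos : ∀ x, R ≤ ‖x‖ → 0 < inner ℝ (F x) x) : ∃ x, F x = 0 := by
  by_contra! hne
  -- modify the field into the identity outside of the ball of radius `2 * R`
  set χ : E → ℝ := fun x => max 0 (min 1 (‖x‖ / R - 1))
  have hχ : Continuous χ := by fun_prop
  have hχ0 : ∀ x, 0 ≤ χ x := fun x => le_max_left _ _
  have hχ1 : ∀ x, χ x ≤ 1 := fun x => max_le zero_le_one (min_le_left _ _)
  have hχR : ∀ x, ‖x‖ ≤ R → χ x = 0 := by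
    intro x hx
    have : ‖x‖ / R ≤ 1 := (div_le_one hR).2 hx
    exact max_eq_left ((min_le_right _ _).trans (by linarith))
  have hχ2 : ∀ x, 2 * R ≤ ‖x‖ → χ x = 1 := by
    intro x hx
    have : 2 ≤ ‖x‖ / R := (le_div_iff₀ hR).2 hx
    simp only [χ]
    rw [min_eq_left (by linarith), max_eq_right zero_le_one]
  set G : E → E := fun x => (1 - χ x) • F x + χ x • x
  have hG : Continuous G := by fun_prop
  have hGne : ∀ x, G x ≠ 0 := by
    intro x hx
    rcases le_or_gt ‖x‖ R with h | h
    · simp [G, hχR x h, hne x] at hx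
    · have h1 : inner ℝ (G x) x = (1 - χ x) * inner ℝ (F x) x + χ x * ‖x‖ ^ 2 := by
        simp only [G, inner_add_left, inner_smul_left, real_inner_self_eq_norm_sq]
        simp
      rw [hx, inner_zero_left] at h1
      have h2 := hpos x h.le
      have h3 : 0 < ‖x‖ ^ 2 := by have := hR.trans h; positivity
      rcases (hχ0 x).eq_or_lt with h4 | h4
      · rw [← h4] at h1; linarith
      · nlinarith [hχ1 x, mul_pos h4 h3, mul_nonneg (sub_nonneg.2 (hχ1 x)) h2.le]
  obtain ⟨Φ, hΦ, hclose, heq, -⟩ := hG.exists_contDiff_approx_and_eqOn 1 hG.norm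
    (fun x => norm_pos_iff.2 (hGne x)) (S := {x | 3 * R ≤ ‖x‖}) (U := {x | 2 * R < ‖x‖})
    (isClosed_le continuous_const continuous_norm)
    ((isOpen_lt continuous_const continuous_norm).mem_nhdsSet.2
      fun x (hx : 3 * R ≤ ‖x‖) => show 2 * R < ‖x‖ by linarith)
    (contDiffOn_id.congr fun x (hx : 2 * R < ‖x‖) => by simp [G, hχ2 x hx.le])
  have hΦne : ∀ x, Φ x ≠ 0 := by
    intro x hx
    have := hclose x
    rw [hx, dist_zero_left] at this
    exact lt_irrefl _ this
  refine not_exists_contDiff_retraction (R := 3 * R) (f := fun x => (3 * R / ‖Φ x‖) • Φ x)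
    (by positivity) ?_ ?_ ?_
  · refine ContDiff.smul ?_ hΦ
    exact contDiff_const.div (hΦ.norm ℝ hΦne) fun x => norm_ne_zero_iff.2 (hΦne x)
  · intro x hx
    have hx' : ‖x‖ = 3 * R := by simpa using hx
    have : Φ x = x := by
      rw [heq (show 3 * R ≤ ‖x‖ from hx'.ge)]
      simp [G, hχ2 x (by rw [hx']; linarith)]
    simp only [this, hx']
    rw [div_self (by positivity), one_smul]
  · intro x
    rw [norm_smul, norm_div, norm_norm, div_mul_cancel₀ _ (norm_ne_zero_iff.2 (hΦne x)),
      Real.norm_of_nonneg (by positivity)]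

end Brouwer

/-! ### Connectedness of cell decompositions -/

section Connectedness

open Set Metric

/-- In dimension at least two, removing a point from a connected open set leaves it connected:
a small punctured ball around the point is connected. -/
lemma IsPreconnected.sdiff_singleton {E : Type*} [NormedAddCommGroup E] [NormedSpace ℝ E]
    (hE : 1 < Module.rank ℝ E) {U : Set E} (hU : IsPreconnected U) (hUo : IsOpen U) (x : E) :
    IsPreconnected (U \ {x}) := by
  by_cases hx : x ∈ U
  swap
  · rwa [sdiff_singleton_eq_self hx]
  obtain ⟨ε, hε, hball⟩ := Metric.isOpen_iff.1 hUo x hx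
  have hpunct : IsPreconnected (ball x ε \ {x}) := by
    set φ := OpenPartialHomeomorph.univBall x ε
    have h := (isConnected_compl_singleton_of_one_lt_rank hE (0 : E)).isPreconnected.image φ
      (OpenPartialHomeomorph.continuous_univBall x ε).continuousOn
    convert h using 1
    have hinj : Function.Injective φ := by
      intro a b hab
      exact φ.injOn (by simp [φ]) (by simp [φ]) hab
    have hrange : range φ = ball x ε := by
      rw [← image_univ, ← OpenPartialHomeomorph.univBall_source x ε, φ.image_source_eq_target,
        OpenPartialHomeomorph.univBall_target x hε]
    rw [compl_eq_univ_sdiff, image_sdiff hinj, image_univ, hrange, image_singleton,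
      OpenPartialHomeomorph.univBall_apply_zero]
  have key : ∀ u v : Set E, IsOpen u → IsOpen v → U \ {x} ⊆ u ∪ v → U \ {x} ∩ (u ∩ v) = ∅ →
      ball x ε \ {x} ⊆ u → U \ {x} ⊆ u := by
    intro u v hu hv huv hdis hsub
    have hopen : IsOpen (v \ {x}) := hv.sdiff isClosed_singleton
    have hcover : U ⊆ (u ∪ ball x ε) ∪ (v \ {x}) := by
      intro y hy
      by_cases hyx : y = x
      · exact Or.inl (Or.inr (hyx ▸ mem_ball_self hε))
      · rcases huv ⟨hy, hyx⟩ with h | h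
        · exact Or.inl (Or.inl h)
        · exact Or.inr ⟨h, hyx⟩
    have hempty : U ∩ ((u ∪ ball x ε) ∩ (v \ {x})) = ∅ := by
      refine eq_empty_of_forall_notMem ?_
      rintro y ⟨hyU, hy, hyv, hyx⟩
      have hyu : y ∈ u := hy.elim id fun hb => hsub ⟨hb, hyx⟩
      have : y ∈ U \ {x} ∩ (u ∩ v) := ⟨⟨hyU, hyx⟩, hyu, hyv⟩
      rw [hdis] at this
      exact this
    rcases isPreconnected_iff_subset_of_disjoint.1 hU _ _ (hu.union isOpen_ball) hopen hcover
      hempty with h | h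
    · rintro y ⟨hyU, hyx⟩
      exact (h hyU).elim id fun hb => hsub ⟨hb, hyx⟩
    · exact absurd rfl (h hx).2
  refine isPreconnected_iff_subset_of_disjoint.2 fun u v hu hv huv hdis => ?_
  have hsub : ball x ε \ {x} ⊆ U \ {x} := sdiff_subset_sdiff_left hball
  rcases isPreconnected_iff_subset_of_disjoint.1 hpunct u v hu hv (hsub.trans huv)
    (subset_eq_empty (inter_subset_inter_left _ hsub) hdis) with h | h
  · exact Or.inl (key u v hu hv huv hdis h)
  · exact Or.inr (key v u hv hu (union_comm u v ▸ huv) (inter_comm u v ▸ hdis) h)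

lemma IsPreconnected.sdiff_finite {E : Type*} [NormedAddCommGroup E] [NormedSpace ℝ E]
    (hE : 1 < Module.rank ℝ E) {U : Set E} (hU : IsPreconnected U) (hUo : IsOpen U) {F : Set E}
    (hF : F.Finite) : IsPreconnected (U \ F) := by
  induction F, hF using Set.Finite.induction_on with
  | empty => simpa using hU
  | @insert a s _ hs ih =>
    have : U \ insert a s = (U \ s) \ {a} := by
      ext y; simp only [mem_sdiff, mem_insert_iff, mem_singleton_iff]; tauto
    rw [this]
    exact ih.sdiff_singleton hE (hUo.sdiff hs.isClosed) a

lemma one_lt_rank_plane : 1 < Module.rank ℝ Plane := by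
  rw [← Module.finrank_eq_rank, finrank_euclideanSpace, Fintype.card_fin]
  norm_num

/-- If a connected open set is decomposed into finitely many cells, and if two cells which have a
boundary point in common are adjacent, apart from a finite set of exceptional points, then any two
cells are linked by a chain of adjacent cells. -/
lemma reflTransGen_of_cells {ι : Type*} [Finite ι] {Ω : Set Plane} (hΩ : IsPreconnected Ω)
    (hΩo : IsOpen Ω) {P : ι → Set Plane} (hPo : ∀ i, IsOpen (P i)) (hPne : ∀ i, (P i).Nonempty)
    (hPsub : ∀ i, P i ⊆ Ω) (hdis : Pairwise fun i j => Disjoint (P i) (P j))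
    (hcov : Ω ⊆ ⋃ i, closure (P i)) {F : Set Plane} (hF : F.Finite) {Adj : ι → ι → Prop}
    (hadj : ∀ i j, i ≠ j → ∀ x ∈ Ω, x ∉ F → x ∈ frontier (P i) → x ∈ frontier (P j) → Adj i j)
    (i j : ι) : Relation.ReflTransGen Adj i j := by
  by_contra hij
  set S : Set ι := {k | Relation.ReflTransGen Adj i k}
  set A : Set Plane := ⋃ k ∈ S, closure (P k)
  set A' : Set Plane := ⋃ k ∈ Sᶜ, closure (P k)
  have hA : IsClosed A := S.toFinite.isClosed_biUnion fun _ _ => isClosed_closure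
  have hA' : IsClosed A' := Sᶜ.toFinite.isClosed_biUnion fun _ _ => isClosed_closure
  have hnonempty : ∀ k, ∃ x ∈ P k, x ∉ F := fun k => by
    obtain ⟨x, hx, hxF⟩ := (hF.countable.dense_compl ℝ).inter_open_nonempty _ (hPo k) (hPne k)
    exact ⟨x, hx, hxF⟩
  have hcover : Ω \ F ⊆ A ∪ A' := by
    rintro x ⟨hx, -⟩
    obtain ⟨k, hk⟩ := mem_iUnion.1 (hcov hx)
    by_cases hkS : k ∈ S
    · exact Or.inl (mem_biUnion hkS hk)
    · exact Or.inr (mem_biUnion (show k ∈ Sᶜ from hkS) hk)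
  obtain ⟨x, ⟨hxΩ, hxF⟩, hxA, hxA'⟩ := isPreconnected_closed_iff.1
    (hΩ.sdiff_finite one_lt_rank_plane hΩo hF) A A' hA hA' hcover
    (by
      obtain ⟨x, hx, hxF⟩ := hnonempty i
      exact ⟨x, ⟨hPsub i hx, hxF⟩, mem_biUnion (show i ∈ S from .refl) (subset_closure hx)⟩)
    (by
      obtain ⟨x, hx, hxF⟩ := hnonempty j
      exact ⟨x, ⟨hPsub j hx, hxF⟩, mem_biUnion (show j ∈ Sᶜ from hij) (subset_closure hx)⟩)
  simp only [A, A', mem_iUnion] at hxA hxA'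
  obtain ⟨k, hk, hxk⟩ := hxA
  obtain ⟨l, hl, hxl⟩ := hxA'
  have hkl : k ≠ l := by rintro rfl; exact hl hk
  have hfront : ∀ a b, a ≠ b → x ∈ closure (P a) → x ∈ closure (P b) → x ∈ frontier (P a) := by
    intro a b hab ha hb
    refine ⟨ha, fun hint => ?_⟩
    rw [(hPo a).interior_eq] at hint
    exact ((hdis hab).closure_right (hPo a)).le_bot ⟨hint, hb⟩
  exact hl (hk.tail (hadj k l hkl x hxΩ hxF (hfront k l hkl hxk hxl)
    (hfront l k hkl.symm hxl hxk)))

end Connectedness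

/-! ### Plane measure -/

section PlaneMeasure

lemma volume_segment (a b : Plane) : volume (segment ℝ a b) = 0 := by
  have hspan : affineSpan ℝ {a, b} ≠ (⊤ : AffineSubspace ℝ Plane) := by
    intro h
    have h1 := (collinear_pair ℝ a b).finrank_le_one
    rw [← direction_affineSpan, h, AffineSubspace.direction_top, finrank_top,
      finrank_euclideanSpace, Fintype.card_fin] at h1
    omega
  refine measure_mono_null ?_ (Measure.addHaar_affineSubspace volume _ hspan)
  rw [← convexHull_pair]
  exact convexHull_subset_affineSpan _

lemma interior_triangle_nonempty {a b p : Plane} (h : cross (b - a) (p - a) ≠ 0) :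
    (interior (convexHull ℝ {p, a, b})).Nonempty := by
  rw [interior_convexHull_nonempty_iff_affineSpan_eq_top, eq_top_iff]
  intro x _
  have ha : a ∈ affineSpan ℝ ({p, a, b} : Set Plane) := subset_affineSpan ℝ _ (by simp)
  have hb : b ∈ affineSpan ℝ ({p, a, b} : Set Plane) := subset_affineSpan ℝ _ (by simp)
  have hp : p ∈ affineSpan ℝ ({p, a, b} : Set Plane) := subset_affineSpan ℝ _ (by simp)
  -- Cramer's rule
  have hx : x = ((cross (x - a) (p - a) / cross (b - a) (p - a)) • (b -ᵥ a) +
      (cross (b - a) (x - a) / cross (b - a) (p - a)) • (p -ᵥ a)) +ᵥ a := by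
    ext i
    simp only [vsub_eq_sub, vadd_eq_add, PiLp.add_apply, PiLp.smul_apply, PiLp.sub_apply,
      smul_eq_mul]
    rw [← sub_eq_iff_eq_add, div_mul_eq_mul_div, div_mul_eq_mul_div, ← add_div, eq_div_iff h]
    fin_cases i <;> simp [cross] <;> ring
  rw [hx]
  exact AffineSubspace.vadd_mem_of_mem_direction (Submodule.add_mem _
    (Submodule.smul_mem _ _ (AffineSubspace.vsub_mem_direction hb ha))
    (Submodule.smul_mem _ _ (AffineSubspace.vsub_mem_direction hp ha))) ha

lemma IsOpenPolygon.measureReal_pos {P S : Set Plane} (hP : IsOpenPolygon P S) :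
    0 < volume.real P :=
  ENNReal.toReal_pos (hP.isOpen.measure_pos _ hP.isConnected.nonempty).ne'
    hP.isBounded.measure_lt_top.ne

end PlaneMeasure

/-! ### Geometry of a mesh -/

namespace MeshData.IsDDFVMesh

open Set

variable {C V I B : Type*} {M : MeshData C V I B} {Ω : Set Plane}

lemma mCell_pos (hM : M.IsDDFVMesh Ω) (K : C) : 0 < M.mCell K := (hM.cell_polygon K).measureReal_pos

lemma mDual_pos (hM : M.IsDDFVMesh Ω) (v : V) : 0 < M.mDual v := (hM.dual_polygon v).measureReal_pos

lemma cross_pos (hM : M.IsDDFVMesh Ω) (e : I ⊕ B) :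
    0 < cross (M.vertex (M.tgt e) - M.vertex (M.src e))
      (M.primalCenter (M.primL e) - M.primalCenter (M.primK e)) := by
  have h1 := hM.orient_left e
  rcases e with i | b
  · have h2 := hM.orient_right i
    simp only [cross, primalCenter, primL, primK, Sum.elim_inl, PiLp.sub_apply] at *
    linarith
  · -- the middle of the edge lies on the straight line through the edge
    have h2 : ∀ k, M.bdMid b k =
        (M.vertex (M.src (.inr b)) k + M.vertex (M.tgt (.inr b)) k) / 2 := by
      intro k
      simp only [bdMid, midpoint_eq_smul_add, PiLp.smul_apply, PiLp.add_apply, smul_eq_mul]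
      rw [invOf_eq_inv]; ring
    simp only [cross, primalCenter, primL, primK, Sum.elim_inl, Sum.elim_inr, PiLp.sub_apply,
      h2] at *
    linarith

lemma mDiamond_pos (hM : M.IsDDFVMesh Ω) (hΩ : Bornology.IsBounded Ω) (e : I ⊕ B) :
    0 < M.mDiamond e := by
  have hsub : M.diamond e ⊆ closure Ω := hM.diamond_cover ▸ subset_iUnion M.diamond e
  refine ENNReal.toReal_pos ?_ (hΩ.closure.subset hsub).measure_lt_top.ne
  refine (lt_of_lt_of_le ((isOpen_interior.measure_pos volume
    (interior_triangle_nonempty (hM.orient_left e).ne)).trans_le (measure_mono interior_subset))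
    (measure_mono subset_union_left)).ne'

lemma volume_frontier [Finite B] (hM : M.IsDDFVMesh Ω) : volume (frontier Ω) = 0 := by
  rw [hM.frontier_eq]
  exact measure_iUnion_null fun b => volume_segment _ _

lemma ae_eq_iUnion_cell [Finite C] [Finite I] [Finite B] (hM : M.IsDDFVMesh Ω) :
    Ω =ᵐ[volume] ⋃ K, M.cell K := by
  refine Filter.EventuallyLE.antisymm ?_ (iUnion_subset hM.cell_subset).eventuallyLE
  refine ae_le_set.2 (measure_mono_null (t := ⋃ K, frontier (M.cell K)) ?_
    (measure_iUnion_null fun K => ?_))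
  · rintro x ⟨hx, hx'⟩
    obtain ⟨K, hK⟩ := mem_iUnion.1 (hM.cell_cover hx)
    refine mem_iUnion.2 ⟨K, hK, fun h => hx' (mem_iUnion.2 ⟨K, interior_subset h⟩)⟩
  · rw [(hM.cell_polygon K).frontier_eq]
    exact measure_iUnion_null fun e => measure_iUnion_null fun _ => volume_segment _ _

lemma ae_eq_iUnion_dualCell [Finite V] [Finite I] [Finite B] (hM : M.IsDDFVMesh Ω) :
    Ω =ᵐ[volume] ⋃ v, M.dualCell v := by
  refine Filter.EventuallyLE.antisymm ?_ (iUnion_subset hM.dual_subset).eventuallyLE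
  refine ae_le_set.2 (measure_mono_null (t := ⋃ v, frontier (M.dualCell v)) ?_
    (measure_iUnion_null fun v => ?_))
  · rintro x ⟨hx, hx'⟩
    obtain ⟨v, hv⟩ := mem_iUnion.1 (hM.dual_cover hx)
    refine mem_iUnion.2 ⟨v, hv, fun h => hx' (mem_iUnion.2 ⟨v, interior_subset h⟩)⟩
  · rw [(hM.dual_polygon v).frontier_eq]
    exact measure_union_null
      (measure_iUnion_null fun e => measure_iUnion_null fun _ => volume_segment _ _)
      (measure_iUnion_null fun b => measure_iUnion_null fun _ => volume_segment _ _)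

/-- Any two interior primal cells are linked by a chain of cells with a common edge. -/
lemma reflTransGen_cell [Finite C] [Finite V] (hM : M.IsDDFVMesh Ω) (hΩ : IsPreconnected Ω)
    (hΩo : IsOpen Ω) (K L : C) :
    Relation.ReflTransGen (fun K L => ∃ i, (M.left (.inl i) = K ∧ M.right i = L) ∨
      (M.left (.inl i) = L ∧ M.right i = K)) K L := by
  refine reflTransGen_of_cells hΩ hΩo (fun K => (hM.cell_polygon K).isOpen)
    (fun K => (hM.cell_polygon K).isConnected.nonempty) hM.cell_subset hM.cell_disjoint
    hM.cell_cover (finite_range M.vertex) (fun K L hKL x _ hxV hxK hxL => ?_) K L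
  rw [(hM.cell_polygon K).frontier_eq] at hxK
  rw [(hM.cell_polygon L).frontier_eq] at hxL
  simp only [mem_iUnion] at hxK hxL
  obtain ⟨e, heK, hxe⟩ := hxK
  obtain ⟨e', heL, hxe'⟩ := hxL
  have hopen : x ∈ M.openEdge e := mem_openSegment_of_ne_left_right
    (fun h => hxV ⟨_, h⟩) (fun h => hxV ⟨_, h⟩) hxe
  have hee' : e = e' := by
    by_contra hne
    exact (hM.edge_disjoint hne).le_bot ⟨hopen, hxe'⟩
  subst hee'
  rcases e with i | b
  · simp only [IsEdgeOf, primK, primL, Sum.elim_inl, Sum.inl.injEq] at heK heL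
    refine ⟨i, ?_⟩
    rcases heK with h1 | h1 <;> rcases heL with h2 | h2
    · exact absurd (h1.symm.trans h2) hKL
    · exact Or.inl ⟨h1, h2⟩
    · exact Or.inr ⟨h2, h1⟩
    · exact absurd (h1.symm.trans h2) hKL
  · simp only [IsEdgeOf, primK, primL, Sum.elim_inr, Sum.inl.injEq, reduceCtorEq, or_false]
      at heK heL
    exact absurd (heK.symm.trans heL) hKL

/-- Any two vertices are linked by a chain of edges. -/
lemma reflTransGen_vertex [Finite C] [Finite V] [Finite B] (hM : M.IsDDFVMesh Ω)
    (hΩ : IsPreconnected Ω) (hΩo : IsOpen Ω) (v w : V) :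
    Relation.ReflTransGen (fun v w => ∃ e, (M.src e = v ∧ M.tgt e = w) ∨
      (M.src e = w ∧ M.tgt e = v)) v w := by
  refine reflTransGen_of_cells hΩ hΩo (fun v => (hM.dual_polygon v).isOpen)
    (fun v => (hM.dual_polygon v).isConnected.nonempty) hM.dual_subset hM.dual_disjoint
    hM.dual_cover (finite_range M.primalCenter) (fun v w hvw x hxΩ hxC hxv hxw => ?_) v w
  -- the half boundary edges of the dual cells do not meet `Ω`
  have hfront : ∀ v, x ∈ frontier (M.dualCell v) → ∃ e, M.IsEndOf v e ∧ x ∈ M.dualEdge e := by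
    intro v hx
    rw [(hM.dual_polygon v).frontier_eq] at hx
    simp only [mem_union, mem_iUnion] at hx
    rcases hx with ⟨e, hve, hxe⟩ | ⟨b, hvb, hxb⟩
    · exact ⟨e, hve, hxe⟩
    · exfalso
      have hedge : x ∈ M.edge (.inr b) := by
        refine (convex_segment _ _).segment_subset ?_ ?_ hxb
        · rcases hvb with h | h
          · rw [← h]; exact left_mem_segment _ _ _
          · rw [← h]; exact right_mem_segment _ _ _
        · exact midpoint_mem_segment _ _
      have : x ∈ frontier Ω := hM.frontier_eq ▸ mem_iUnion.2 ⟨b, hedge⟩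
      exact this.2 (hΩo.interior_eq.symm ▸ hxΩ)
  obtain ⟨e, hve, hxe⟩ := hfront v hxv
  obtain ⟨e', hwe, hxe'⟩ := hfront w hxw
  have hopen : x ∈ M.openDualEdge e := mem_openSegment_of_ne_left_right
    (fun h => hxC ⟨_, h⟩) (fun h => hxC ⟨_, h⟩) hxe
  have hee' : e = e' := by
    by_contra hne
    exact (hM.dualEdge_disjoint hne).le_bot ⟨hopen, hxe'⟩
  subst hee'
  refine ⟨e, ?_⟩
  rcases hve with h1 | h1 <;> rcases hwe with h2 | h2
  · exact absurd (h1.symm.trans h2) hvw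
  · exact Or.inl ⟨h1, h2⟩
  · exact Or.inr ⟨h2, h1⟩
  · exact absurd (h1.symm.trans h2) hvw

/-- A property of the unknowns which propagates along the edges of both meshes and holds for one
interior primal cell and one dual cell holds for all unknowns. -/
lemma forall_of_propagates [Finite C] [Finite V] [Finite B] (hM : M.IsDDFVMesh Ω)
    (hΩ : IsPreconnected Ω) (hΩo : IsOpen Ω) {p : (C ⊕ B) ⊕ V → Prop}
    (hprim : ∀ e, p (.inl (M.primK e)) ↔ p (.inl (M.primL e)))
    (hdual : ∀ e, p (.inr (M.src e)) ↔ p (.inr (M.tgt e)))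
    {K : C} (hK : p (.inl (.inl K))) {v : V} (hv : p (.inr v)) : ∀ i, p i := by
  have hcell : ∀ L, p (.inl (.inl L)) := by
    intro L
    induction hM.reflTransGen_cell hΩ hΩo K L with
    | refl => exact hK
    | tail _ h ih =>
      obtain ⟨i, ⟨rfl, rfl⟩ | ⟨rfl, rfl⟩⟩ := h
      · exact (hprim (.inl i)).1 ih
      · exact (hprim (.inl i)).2 ih
  have hvert : ∀ w, p (.inr w) := by
    intro w
    induction hM.reflTransGen_vertex hΩ hΩo v w with
    | refl => exact hv
    | tail _ h ih =>
      obtain ⟨e, ⟨rfl, rfl⟩ | ⟨rfl, rfl⟩⟩ := h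
      · exact (hdual e).1 ih
      · exact (hdual e).2 ih
  rintro ((L | b) | w)
  · exact hcell L
  · exact (hprim (.inr b)).1 (hcell _)
  · exact hvert w

end MeshData.IsDDFVMesh

/-- If finitely many cells decompose `Ω` up to a null set and `u` has positive mass on `Ω`, then `u`
has positive mass on one of the cells. -/
lemma exists_setIntegral_pos {ι : Type*} [Fintype ι] {Ω : Set Plane} {P : ι → Set Plane}
    (hP : ∀ i, IsOpen (P i)) (hPΩ : ∀ i, P i ⊆ Ω)
    (hdis : Pairwise fun i j => Disjoint (P i) (P j)) (hae : Ω =ᵐ[volume] ⋃ i, P i)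
    {u : Plane → ℝ} (hu : IntegrableOn u Ω) (hpos : 0 < ∫ x in Ω, u x) :
    ∃ i, 0 < ∫ x in P i, u x := by
  by_contra! h
  rw [setIntegral_congr_set hae, integral_iUnion_fintype (fun i => (hP i).measurableSet) hdis
    fun i => hu.mono_set (hPΩ i)] at hpos
  exact hpos.not_ge (Finset.sum_nonpos fun i _ => h i)

/-! ### Coercivity of the local matrices -/

namespace MeshData

open Set

variable {C V I B : Type*} {M : MeshData C V I B} {Ω : Set Plane}

lemma IsDDFVMesh.restrict_diamond_le [Finite B] (hM : M.IsDDFVMesh Ω) (e : I ⊕ B) :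
    volume.restrict (M.diamond e) ≤ volume.restrict Ω := by
  refine Measure.restrict_mono_ae (ae_le_set.2 (measure_mono_null ?_ hM.volume_frontier))
  rintro x ⟨hx, hxΩ⟩
  have : x ∈ closure Ω := hM.diamond_cover ▸ mem_iUnion.2 ⟨e, hx⟩
  exact ⟨this, fun h => hxΩ (interior_subset h)⟩

lemma IsDDFVMesh.integrableOn_diamond [Finite B] (hM : M.IsDDFVMesh Ω)
    (hΩ : Bornology.IsBounded Ω) {Λ : Plane → Matrix (Fin 2) (Fin 2) ℝ} {lm lM : ℝ}
    (hΛ : IsEllipticTensor Ω Λ lm lM) (e : I ⊕ B) (i j : Fin 2) :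
    IntegrableOn (fun x => Λ x i j) (M.diamond e) := by
  have : IsFiniteMeasure (volume.restrict Ω) :=
    isFiniteMeasure_restrict.2 hΩ.measure_lt_top.ne
  exact ((hΛ.memLp i j).integrable le_top).mono_measure (hM.restrict_diamond_le e)

lemma IsDDFVMesh.meanTensor_symm [Finite B] (hM : M.IsDDFVMesh Ω)
    {Λ : Plane → Matrix (Fin 2) (Fin 2) ℝ} {lm lM : ℝ}
    (hΛ : IsEllipticTensor Ω Λ lm lM) (e : I ⊕ B) :
    M.meanTensor Λ e 0 1 = M.meanTensor Λ e 1 0 := by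
  simp only [meanTensor, of_apply]
  congr 1
  refine integral_congr_ae ?_
  filter_upwards [ae_mono (hM.restrict_diamond_le e) hΛ.symm] with x hx
  exact (hx.apply 1 0)

lemma IsDDFVMesh.le_meanTensor [Finite B] (hM : M.IsDDFVMesh Ω)
    (hΩ : Bornology.IsBounded Ω) {Λ : Plane → Matrix (Fin 2) (Fin 2) ℝ} {lm lM : ℝ}
    (hΛ : IsEllipticTensor Ω Λ lm lM) (e : I ⊕ B) (v : Fin 2 → ℝ) :
    lm * (v ⬝ᵥ v) ≤ (M.meanTensor Λ e *ᵥ v) ⬝ᵥ v := by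
  have hm := hM.mDiamond_pos hΩ e
  have hint : ∀ i j, Integrable (fun x => Λ x i j) (volume.restrict (M.diamond e)) :=
    hM.integrableOn_diamond hΩ hΛ e
  have hexp : ∀ A : Matrix (Fin 2) (Fin 2) ℝ, (A *ᵥ v) ⬝ᵥ v =
      A 0 0 * (v 0 * v 0) + A 0 1 * (v 0 * v 1) + A 1 0 * (v 0 * v 1) + A 1 1 * (v 1 * v 1) := by
    intro A
    simp only [mulVec, dotProduct, Fin.sum_univ_two]
    ring
  have hI : ∀ (i j) (t : ℝ), Integrable (fun x => Λ x i j * t) (volume.restrict (M.diamond e)) :=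
    fun i j t => (hint i j).mul_const t
  have hmean : (M.meanTensor Λ e *ᵥ v) ⬝ᵥ v =
      (1 / M.mDiamond e) * ∫ x in M.diamond e, (Λ x *ᵥ v) ⬝ᵥ v := by
    have h1 := integral_add (hI 0 0 (v 0 * v 0)) (hI 0 1 (v 0 * v 1))
    have h2 := integral_add ((hI 0 0 (v 0 * v 0)).add (hI 0 1 (v 0 * v 1))) (hI 1 0 (v 0 * v 1))
    have h3 := integral_add (((hI 0 0 (v 0 * v 0)).add (hI 0 1 (v 0 * v 1))).add
      (hI 1 0 (v 0 * v 1))) (hI 1 1 (v 1 * v 1))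
    simp only [Pi.add_apply] at h2 h3
    simp only [hexp]
    rw [h3, h2, h1]
    simp only [integral_mul_const, meanTensor, of_apply]
    ring
  have hfin : volume (M.diamond e) ≠ ⊤ := fun h => hm.ne' (by simp [mDiamond, Measure.real, h])
  have hle : ∫ _ in M.diamond e, lm * (v ⬝ᵥ v) ≤ ∫ x in M.diamond e, (Λ x *ᵥ v) ⬝ᵥ v := by
    refine integral_mono_ae (integrableOn_const hfin) ?_ ?_
    · simp only [hexp]
      exact (((hI 0 0 _).add (hI 0 1 _)).add (hI 1 0 _)).add (hI 1 1 _)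
    · filter_upwards [ae_mono (hM.restrict_diamond_le e) hΛ.lower] with x hx
      exact hx v
  rw [setIntegral_const, smul_eq_mul] at hle
  rw [hmean, one_div, ← div_eq_inv_mul, le_div_iff₀ hm, mul_comm]
  exact hle

/-- The local matrix `𝔸^D` is coercive: its quadratic form at `d` is that of `Λ^D / (4 m_D)` at the
vector `d₀ m_σ n + d₁ m_{σ*} n*`, and the two normals are linearly independent. -/
lemma IsDDFVMesh.exists_localMatrix_coercive [Finite B] (hM : M.IsDDFVMesh Ω)
    (hΩ : Bornology.IsBounded Ω) {Λ : Plane → Matrix (Fin 2) (Fin 2) ℝ} {lm lM : ℝ}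
    (hΛ : IsEllipticTensor Ω Λ lm lM) (e : I ⊕ B) :
    ∃ c > 0, ∀ d : Fin 2 → ℝ, c * (d 0 ^ 2 + d 1 ^ 2) ≤ d ⬝ᵥ (M.localMatrix Λ e *ᵥ d) := by
  have hm := hM.mDiamond_pos hΩ e
  have hX := hM.cross_pos e
  set t := M.vertex (M.tgt e) - M.vertex (M.src e) with ht
  set s := M.primalCenter (M.primL e) - M.primalCenter (M.primK e) with hs
  set Q := t 0 ^ 2 + t 1 ^ 2 + s 0 ^ 2 + s 1 ^ 2
  have hcross : cross t s = t 0 * s 1 - t 1 * s 0 := rfl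
  have hne : M.mEdge e ≠ 0 := by
    intro h
    have : t = 0 := sub_eq_zero.2 (dist_eq_zero.1 h).symm
    simp [this, cross] at hX
  have hne' : M.mDualEdge e ≠ 0 := by
    intro h
    have : s = 0 := sub_eq_zero.2 (dist_eq_zero.1 h).symm
    simp [this, cross] at hX
  have hQ : 0 < Q := by
    by_contra h
    have h0 : t 0 = 0 := by
      nlinarith [sq_nonneg (t 0), sq_nonneg (t 1), sq_nonneg (s 0), sq_nonneg (s 1)]
    have h1 : t 1 = 0 := by
      nlinarith [sq_nonneg (t 0), sq_nonneg (t 1), sq_nonneg (s 0), sq_nonneg (s 1)]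
    simp [hcross, h0, h1] at hX
  refine ⟨lm / (4 * M.mDiamond e) * (cross t s ^ 2 / Q),
    by have := hΛ.pos; positivity, fun d => ?_⟩
  set w : Fin 2 → ℝ := ![-(t 1) * d 0 + s 1 * d 1, t 0 * d 0 - s 0 * d 1]
  have hw0 : w 0 = -(t 1) * d 0 + s 1 * d 1 := rfl
  have hw1 : w 1 = t 0 * d 0 - s 0 * d 1 := rfl
  have hquad : d ⬝ᵥ (M.localMatrix Λ e *ᵥ d) =
      1 / (4 * M.mDiamond e) * ((M.meanTensor Λ e *ᵥ w) ⬝ᵥ w) := by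
    have hsymm := hM.meanTensor_symm hΛ e
    simp only [localMatrix, normal, dualNormal, mulVec, dotProduct, Fin.sum_univ_two, ← ht, ← hs,
      hw0, hw1, of_apply, cons_val_zero, cons_val_one, cons_val', cons_val_fin_one, hsymm]
    field_simp
    ring
  -- Cramer's rule bounds `d` in terms of `w`
  have hcramer : cross t s ^ 2 * (d 0 ^ 2 + d 1 ^ 2) ≤ Q * (w 0 ^ 2 + w 1 ^ 2) := by
    have h0 : cross t s * d 0 = s 0 * w 0 + s 1 * w 1 := by rw [hcross, hw0, hw1]; ring
    have h1 : cross t s * d 1 = t 0 * w 0 + t 1 * w 1 := by rw [hcross, hw0, hw1]; ring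
    calc cross t s ^ 2 * (d 0 ^ 2 + d 1 ^ 2) = (cross t s * d 0) ^ 2 + (cross t s * d 1) ^ 2 := by
          ring
      _ = (s 0 * w 0 + s 1 * w 1) ^ 2 + (t 0 * w 0 + t 1 * w 1) ^ 2 := by rw [h0, h1]
      _ ≤ Q * (w 0 ^ 2 + w 1 ^ 2) := by
          nlinarith [sq_nonneg (s 0 * w 1 - s 1 * w 0), sq_nonneg (t 0 * w 1 - t 1 * w 0)]
  have hlow := hM.le_meanTensor hΩ hΛ e w
  have hww : w ⬝ᵥ w = w 0 ^ 2 + w 1 ^ 2 := by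
    simp only [dotProduct, Fin.sum_univ_two]; ring
  rw [hww] at hlow
  rw [hquad]
  calc lm / (4 * M.mDiamond e) * (cross t s ^ 2 / Q) * (d 0 ^ 2 + d 1 ^ 2)
      = 1 / (4 * M.mDiamond e) * (lm * (cross t s ^ 2 * (d 0 ^ 2 + d 1 ^ 2) / Q)) := by ring
    _ ≤ 1 / (4 * M.mDiamond e) * (lm * (w 0 ^ 2 + w 1 ^ 2)) := by
        have := hΛ.pos
        gcongr
        rw [div_le_iff₀ hQ, mul_comm _ Q]
        exact hcramer
    _ ≤ _ := by gcongr

end MeshData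

/-! ### Mean functions -/

namespace IsMeanFunction

variable {r : ℝ → ℝ → ℝ}

/-- A mean function is continuous, since it is monotone and homogeneous. -/
lemma continuousOn (hr : IsMeanFunction r) :
    ContinuousOn (fun p : ℝ × ℝ => r p.1 p.2) {p | 0 < p.1 ∧ 0 < p.2} := by
  rintro ⟨x, y⟩ ⟨hx, hy⟩
  simp only at hx hy
  have hmax : Filter.Tendsto (fun p : ℝ × ℝ => max (p.1 / x) (p.2 / y) * r x y)
      (nhdsWithin (x, y) {p | 0 < p.1 ∧ 0 < p.2}) (nhds (r x y)) := by
    have : Continuous fun p : ℝ × ℝ => max (p.1 / x) (p.2 / y) * r x y := by fun_prop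
    have h := (this.tendsto (x, y)).mono_left
      (nhdsWithin_le_nhds (s := {p : ℝ × ℝ | 0 < p.1 ∧ 0 < p.2}))
    simpa [div_self hx.ne', div_self hy.ne'] using h
  have hmin : Filter.Tendsto (fun p : ℝ × ℝ => min (p.1 / x) (p.2 / y) * r x y)
      (nhdsWithin (x, y) {p | 0 < p.1 ∧ 0 < p.2}) (nhds (r x y)) := by
    have : Continuous fun p : ℝ × ℝ => min (p.1 / x) (p.2 / y) * r x y := by fun_prop
    have h := (this.tendsto (x, y)).mono_left
      (nhdsWithin_le_nhds (s := {p : ℝ × ℝ | 0 < p.1 ∧ 0 < p.2}))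
    simpa [div_self hx.ne', div_self hy.ne'] using h
  refine tendsto_of_tendsto_of_tendsto_of_le_of_le' hmin hmax ?_ ?_
  · filter_upwards [self_mem_nhdsWithin] with p hp
    obtain ⟨hp1, hp2⟩ := hp
    have hpos : 0 < min (p.1 / x) (p.2 / y) := lt_min (by positivity) (by positivity)
    rw [← hr.homog _ _ _ hpos hx hy]
    have h1 : min (p.1 / x) (p.2 / y) * x ≤ p.1 := (le_div_iff₀ hx).1 (min_le_left _ _)
    have h2 : min (p.1 / x) (p.2 / y) * y ≤ p.2 := (le_div_iff₀ hy).1 (min_le_right _ _)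
    exact (hr.mono_left _ _ _ (by positivity) h1 (by positivity)).trans
      (hr.mono_right _ _ _ hp1 (by positivity) h2)
  · filter_upwards [self_mem_nhdsWithin] with p hp
    obtain ⟨hp1, hp2⟩ := hp
    have hpos : 0 < max (p.1 / x) (p.2 / y) := lt_max_of_lt_left (by positivity)
    rw [← hr.homog _ _ _ hpos hx hy]
    have h1 : p.1 ≤ max (p.1 / x) (p.2 / y) * x := (div_le_iff₀ hx).1 (le_max_left _ _)
    have h2 : p.2 ≤ max (p.1 / x) (p.2 / y) * y := (div_le_iff₀ hy).1 (le_max_right _ _)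
    exact (hr.mono_left _ _ _ hp1 h1 hp2).trans
      (hr.mono_right _ _ _ (by positivity) hp2 h2)

/-- If `x` is bounded from below by `a > 0`, a bound on the dissipation
`r(x, y) (log x - log y + q)²` bounds the difference of the logarithms. This uses monotonicity if
`x ≤ y`, and the comparison of `r` with the logarithmic mean if `y < x`. -/
lemma abs_log_sub_log_le (hr : IsMeanFunction r) {a x y q c : ℝ} (ha : 0 < a) (hax : a ≤ x)
    (hy : 0 < y) (h : r x y * (Real.log x - Real.log y + q) ^ 2 ≤ c) :
    |Real.log x - Real.log y| ≤ 1 + 2 * |q| + 8 * (c / a) := by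
  have hx : 0 < x := ha.trans_le hax
  have hc : 0 ≤ c := le_trans (mul_nonneg (hr.pos x y hx hy).le (sq_nonneg _)) h
  have hca : 0 ≤ c / a := by positivity
  set D := Real.log x - Real.log y
  rcases le_or_gt x y with hxy | hxy
  · have h1 : a ≤ r x y := by
      have := hr.mono_right x x y hx hx hxy
      rw [hr.diag x hx] at this
      exact hax.trans this
    have h2 : (D + q) ^ 2 ≤ c / a := by
      rw [le_div_iff₀ ha, mul_comm]
      exact (mul_le_mul_of_nonneg_right h1 (sq_nonneg _)).trans h
    have h3 : |D + q| ≤ 1 + c / a := by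
      rw [← sq_abs] at h2
      nlinarith [abs_nonneg (D + q)]
    have h4 : |D| ≤ |D + q| + |q| := by simpa using abs_sub (D + q) q
    linarith [abs_nonneg q]
  · have hD : 0 < D := sub_pos.2 (Real.log_lt_log hy hxy)
    rw [abs_of_pos hD]
    by_contra! hlarge
    have h1 := hr.lower x y hx hy hxy.ne'
    have hq : |q| ≤ D / 2 := by linarith [abs_nonneg q]
    have hxy2 : 2 * y ≤ x := by
      have : D + 1 ≤ Real.exp D := Real.add_one_le_exp D
      rw [Real.exp_sub, Real.exp_log hx, Real.exp_log hy] at this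
      have h2 : 2 ≤ x / y := by linarith [abs_nonneg q]
      exact (le_div_iff₀ hy).1 h2
    have h2 : a / (2 * D) ≤ r x y := by
      refine le_trans ?_ h1
      rw [div_le_div_iff₀ (by positivity) hD]
      nlinarith
    have h3 : D ^ 2 / 4 ≤ (D + q) ^ 2 := by
      have : D / 2 ≤ D + q := by linarith [neg_abs_le q]
      nlinarith
    have h4 : a / (2 * D) * (D ^ 2 / 4) ≤ c :=
      (mul_le_mul h2 h3 (by positivity) (hr.pos x y hx hy).le).trans h
    have h5 : a / (2 * D) * (D ^ 2 / 4) = a * D / 8 := by field_simp; ring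
    rw [h5] at h4
    have h6 : D ≤ 8 * (c / a) := by
      rw [mul_div_assoc', le_div_iff₀ ha]
      linarith
    linarith [abs_nonneg q]

end IsMeanFunction

namespace MeshData

variable {C V I B : Type*} {M : MeshData C V I B} {f r : ℝ → ℝ → ℝ}

/-- The two averages allowed in the reconstruction dominate half of each argument. -/
lemma half_le_of_max_or_mean (hf : (∀ x y, f x y = max x y) ∨ (∀ x y, f x y = (x + y) / 2))
    {x y : ℝ} (hx : 0 < x) (hy : 0 < y) : x / 2 ≤ f x y ∧ y / 2 ≤ f x y := by
  rcases hf with hf | hf <;> rw [hf]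
  · exact ⟨(half_le_self hx.le).trans (le_max_left _ _),
      (half_le_self hy.le).trans (le_max_right _ _)⟩
  · constructor <;> linarith

lemma half_le_recon (hr : IsMeanFunction r)
    (hf : (∀ x y, f x y = max x y) ∨ (∀ x y, f x y = (x + y) / 2))
    {w : (C ⊕ B) ⊕ V → ℝ} (hw : ∀ i, 0 < w i) (e : I ⊕ B) :
    r (w (.inl (M.primK e))) (w (.inl (M.primL e))) / 2 ≤ M.recon f r w e ∧
      r (w (.inr (M.src e))) (w (.inr (M.tgt e))) / 2 ≤ M.recon f r w e :=
  half_le_of_max_or_mean hf (hr.pos _ _ (hw _) (hw _)) (hr.pos _ _ (hw _) (hw _))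

lemma recon_pos (hr : IsMeanFunction r)
    (hf : (∀ x y, f x y = max x y) ∨ (∀ x y, f x y = (x + y) / 2))
    {w : (C ⊕ B) ⊕ V → ℝ} (hw : ∀ i, 0 < w i) (e : I ⊕ B) : 0 < M.recon f r w e :=
  (half_pos (hr.pos _ _ (hw _) (hw _))).trans_le (half_le_recon hr hf hw e).1

end MeshData

/-! ### Elementary inequalities -/

/-- For a nonnegative previous value `u`, the term in time `(w - u) x`, with `w = e^{x - q}`, is
bounded from below. -/
lemma le_exp_sub_sub_mul (q u x : ℝ) (hu : 0 ≤ u) :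
    -(Real.exp (-q) + u ^ 2 * Real.exp q) ≤ (Real.exp (x - q) - u) * x := by
  have h1 : Real.exp (-q) * Real.exp q = 1 := by rw [← Real.exp_add]; simp
  have h2 : Real.exp (x - q) = Real.exp (-q) * Real.exp x := by rw [← Real.exp_add]; ring_nf
  have hp := Real.exp_pos (-q)
  have hp' := Real.exp_pos q
  have hx := Real.add_one_le_exp x
  rw [h2]
  rcases le_or_gt x 0 with h | h
  · have h3 : -1 ≤ Real.exp x * x := by
      have := Real.add_one_le_exp (-x)
      have h4 : Real.exp x * Real.exp (-x) = 1 := by rw [← Real.exp_add]; simp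
      nlinarith [Real.exp_pos x]
    nlinarith [mul_nonneg hu (neg_nonneg.2 h), mul_nonneg (sq_nonneg u) hp'.le,
      mul_le_mul_of_nonneg_left h3 hp.le]
  · have h3 : x * x ≤ Real.exp x * x := mul_le_mul_of_nonneg_right (by linarith) h.le
    have h4 : Real.exp (-q) * (x * x) - u * x + u ^ 2 * Real.exp q =
        Real.exp (-q) * (x - u * Real.exp q / 2) ^ 2 + 3 / 4 * (u ^ 2 * Real.exp q) := by
      linear_combination (u * x - u ^ 2 * Real.exp q / 4) * h1
    nlinarith [mul_le_mul_of_nonneg_left h3 hp.le, mul_nonneg (sq_nonneg u) hp'.le,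
      mul_nonneg hp.le (sq_nonneg (x - u * Real.exp q / 2))]

/-- For a positive previous value `u`, an upper bound on the term in time `(w - u) x`, with
`w = e^{x - q}`, bounds `x` on both sides. For `u = 0` it does not bound `x` from below. -/
lemma abs_le_of_exp_sub_sub_mul_le {q u x c : ℝ} (hu : 0 < u)
    (h : (Real.exp (x - q) - u) * x ≤ c) :
    |x| ≤ (|c| + Real.exp (-q)) / u + (u + 1) * Real.exp q + |c| := by
  have h1 : Real.exp (-q) * Real.exp q = 1 := by rw [← Real.exp_add]; simp
  have h2 : Real.exp (x - q) = Real.exp (-q) * Real.exp x := by rw [← Real.exp_add]; ring_nf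
  have hp := Real.exp_pos (-q)
  have hp' := Real.exp_pos q
  have hcc := le_abs_self c
  have hc0 := abs_nonneg c
  have hA : 0 ≤ (|c| + Real.exp (-q)) / u := by positivity
  have hB : 0 ≤ (u + 1) * Real.exp q := by positivity
  rw [h2] at h
  rcases le_or_gt x 0 with hx | hx
  · have h3 : -1 ≤ Real.exp x * x := by
      have := Real.add_one_le_exp (-x)
      have h4 : Real.exp x * Real.exp (-x) = 1 := by rw [← Real.exp_add]; simp
      nlinarith [Real.exp_pos x]
    rw [abs_of_nonpos hx]
    have : -x ≤ (|c| + Real.exp (-q)) / u := by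
      rw [le_div_iff₀ hu]
      nlinarith [mul_le_mul_of_nonneg_left h3 hp.le]
    linarith
  · rw [abs_of_pos hx]
    by_contra! hlarge
    have hx1 : (u + 1) * Real.exp q < x := by linarith
    have h3 : u + 1 ≤ Real.exp (-q) * Real.exp x := by
      have : (u + 1) * Real.exp q ≤ Real.exp x := by linarith [Real.add_one_le_exp x]
      calc u + 1 = Real.exp (-q) * ((u + 1) * Real.exp q) := by linear_combination -(u + 1) * h1
        _ ≤ _ := by gcongr
    nlinarith

/-- In a finite sum with nonpositive value, lower bounds on the terms give upper bounds. -/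
lemma le_sum_of_sum_nonpos {ι : Type*} [Fintype ι] {t c : ι → ℝ} (hc : ∀ i, 0 ≤ c i)
    (ht : ∀ i, -c i ≤ t i) (hsum : ∑ i, t i ≤ 0) (i : ι) : t i ≤ ∑ j, c j := by
  have h1 : t i + c i ≤ ∑ j, (t j + c j) :=
    Finset.single_le_sum (f := fun j => t j + c j) (fun j _ => by linarith [ht j])
      (Finset.mem_univ i)
  rw [Finset.sum_add_distrib] at h1
  linarith [hc i]

/-- Convexity of `s Φ₁(· / s)`, in the form needed for the entropy: the value `a` may vanish. -/
lemma entropy_sub_entropy_le {a b s : ℝ} (ha : 0 ≤ a) (hb : 0 < b) (hs : 0 < s) :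
    s * (b / s * Real.log (b / s) - b / s + 1) - s * (a / s * Real.log (a / s) - a / s + 1) ≤
      (b - a) * Real.log (b / s) := by
  have e : ∀ z, s * (z / s * Real.log (z / s) - z / s + 1) = z * Real.log (z / s) - z + s := by
    intro z; field_simp
  rw [e, e]
  rcases ha.eq_or_lt with rfl | ha
  · simp; linarith
  · have h1 := Real.log_le_sub_one_of_pos (div_pos hb ha)
    rw [Real.log_div hb.ne' ha.ne'] at h1
    rw [Real.log_div hb.ne' hs.ne', Real.log_div ha.ne' hs.ne']
    have h2 : a * (Real.log b - Real.log a) ≤ a * (b / a - 1) := by gcongr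
    have h3 : a * (b / a - 1) = b - a := by field_simp
    nlinarith

/-- Under conservation of mass, the constant part of `log (b / s) = log b + q - log ρ` does not
contribute to the variation of the entropy relative to `s = ρ e^{-q}`. -/
lemma sum_entropy_sub_le {ι : Type*} [Fintype ι] {m a b q : ι → ℝ} {ρ : ℝ} (hρ : 0 < ρ)
    (hm : ∀ i, 0 ≤ m i) (ha : ∀ i, 0 ≤ a i) (hb : ∀ i, 0 < b i)
    (hmass : ∑ i, m i * (b i - a i) = 0) {s : ι → ℝ} (hs : ∀ i, s i = ρ * Real.exp (-q i)) :
    ∑ i, m i * (s i * (b i / s i * Real.log (b i / s i) - b i / s i + 1)) -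
        ∑ i, m i * (s i * (a i / s i * Real.log (a i / s i) - a i / s i + 1)) ≤
      ∑ i, m i * (b i - a i) * (Real.log (b i) + q i) := by
  have hspos : ∀ i, 0 < s i := fun i => by rw [hs]; positivity
  have hlog : ∀ i, Real.log (b i / s i) = Real.log (b i) + q i - Real.log ρ := by
    intro i
    rw [Real.log_div (hb i).ne' (hspos i).ne', hs, Real.log_mul hρ.ne' (Real.exp_pos _).ne',
      Real.log_exp]
    ring
  calc _ = ∑ i, m i * (s i * (b i / s i * Real.log (b i / s i) - b i / s i + 1) -
        s i * (a i / s i * Real.log (a i / s i) - a i / s i + 1)) := by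
        rw [← Finset.sum_sub_distrib]
        exact Finset.sum_congr rfl fun i _ => by ring
    _ ≤ ∑ i, m i * ((b i - a i) * Real.log (b i / s i)) :=
        Finset.sum_le_sum fun i _ =>
          mul_le_mul_of_nonneg_left (entropy_sub_entropy_le (ha i) (hb i) (hspos i)) (hm i)
    _ = ∑ i, m i * (b i - a i) * (Real.log (b i) + q i) -
        (∑ i, m i * (b i - a i)) * Real.log ρ := by
        rw [Finset.sum_mul, ← Finset.sum_sub_distrib]
        exact Finset.sum_congr rfl fun i _ => by rw [hlog]; ring
    _ = _ := by rw [hmass, zero_mul, sub_zero]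

/-! ### Existence of a solution of the nonlinear system -/

lemma norm_le_sum_abs {ι : Type*} [Fintype ι] (x : EuclideanSpace ℝ ι) : ‖x‖ ≤ ∑ i, |x i| := by
  classical
  calc ‖x‖ = ‖∑ i, EuclideanSpace.single i (x i)‖ := by
        congr 1
        ext j
        simp [Pi.single_apply]
    _ ≤ ∑ i, ‖EuclideanSpace.single i (x i)‖ := norm_sum_le _ _
    _ = _ := by simp

namespace MeshData

open Set

variable {C V I B : Type*} {M : MeshData C V I B} {Ω : Set Plane}
  {Λ : Plane → Matrix (Fin 2) (Fin 2) ℝ} {f r : ℝ → ℝ → ℝ} {W : Plane → ℝ}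

/-- The positive vector with discrete potential `x`: the inverse of `MeshData.potential`. -/
noncomputable def density (M : MeshData C V I B) (W : Plane → ℝ) (x : (C ⊕ B) ⊕ V → ℝ) : (C ⊕ B) ⊕ V → ℝ :=
  fun i => Real.exp (x i - M.nodal W i)

lemma density_pos (x : (C ⊕ B) ⊕ V → ℝ) (i : (C ⊕ B) ⊕ V) : 0 < M.density W x i :=
  Real.exp_pos _

lemma potential_density (x : (C ⊕ B) ⊕ V → ℝ) : M.potential W (M.density W x) = x := by
  funext i
  simp [potential, density]

lemma delta_add (u v : (C ⊕ B) ⊕ V → ℝ) (e : I ⊕ B) :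
    M.delta (u + v) e = M.delta u e + M.delta v e := by
  ext i; fin_cases i <;> simp [delta] <;> ring

lemma delta_smul (a : ℝ) (u : (C ⊕ B) ⊕ V → ℝ) (e : I ⊕ B) :
    M.delta (a • u) e = a • M.delta u e := by
  ext i; fin_cases i <;> simp [delta] <;> ring

lemma continuous_delta (e : I ⊕ B) : Continuous fun u => M.delta u e := by
  refine continuous_pi fun i => ?_
  fin_cases i
  · exact (continuous_apply _).sub (continuous_apply _)
  · exact (continuous_apply _).sub (continuous_apply _)

lemma continuous_density : Continuous fun x => M.density W x :=
  continuous_pi fun i => Real.continuous_exp.comp ((continuous_apply i).sub continuous_const)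

lemma continuous_recon_density (hr : IsMeanFunction r)
    (hf : (∀ x y, f x y = max x y) ∨ (∀ x y, f x y = (x + y) / 2)) (e : I ⊕ B) :
    Continuous fun x => M.recon f r (M.density W x) e := by
  have h : ∀ i j, Continuous fun x => r (M.density W x i) (M.density W x j) := fun i j =>
    hr.continuousOn.comp_continuous
      (((continuous_apply i).comp continuous_density).prodMk
        ((continuous_apply j).comp continuous_density))
      fun x => ⟨density_pos x i, density_pos x j⟩
  rcases hf with hf | hf <;> simp only [recon, hf]
  · exact (h _ _).max (h _ _)
  · exact ((h _ _).add (h _ _)).div_const 2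

variable [Fintype C] [Fintype V] [Fintype I] [Fintype B]

/-- The left-hand side of the nonlinear system at the density of potential `x`, as a linear form in
the test vector. -/
noncomputable def residual (M : MeshData C V I B) (W : Plane → ℝ) (Λ : Plane → Matrix (Fin 2) (Fin 2) ℝ)
    (f r : ℝ → ℝ → ℝ) (Δt : ℝ) (u x : (C ⊕ B) ⊕ V → ℝ) : ((C ⊕ B) ⊕ V → ℝ) →ₗ[ℝ] ℝ where
  toFun ψ := M.bracket (fun i => (M.density W x i - u i) / Δt) ψ +
    M.diffusion Λ f r (M.density W x) x ψ
  map_add' ψ φ := by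
    simp only [bracket, diffusion, delta_add, mulVec_add, dotProduct_add, mul_add, add_mul,
      Pi.add_apply, Finset.sum_add_distrib]
    ring
  map_smul' a ψ := by
    have h1 : ∀ K, M.mCell K * (a • ψ) (.inl (.inl K)) =
        a * (M.mCell K * ψ (.inl (.inl K))) := fun K => by simp; ring
    have h2 : ∀ v, M.mDual v * (a • ψ) (.inr v) = a * (M.mDual v * ψ (.inr v)) :=
      fun v => by simp; ring
    simp only [bracket, diffusion, delta_smul, mulVec_smul, dotProduct_smul, h1, h2, smul_eq_mul,
      mul_assoc, mul_left_comm _ a, ← Finset.mul_sum, ← mul_add, RingHom.id_apply]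

lemma continuous_residual (hr : IsMeanFunction r)
    (hf : (∀ x y, f x y = max x y) ∨ (∀ x y, f x y = (x + y) / 2)) (Δt : ℝ)
    (u ψ : (C ⊕ B) ⊕ V → ℝ) : Continuous fun x => M.residual W Λ f r Δt u x ψ := by
  have hd : ∀ i, Continuous fun x => M.density W x i := fun i =>
    (continuous_apply i).comp continuous_density
  have hrec := continuous_recon_density (M := M) (W := W) hr hf
  have hdel : ∀ e, Continuous fun x => M.delta x e := continuous_delta
  simp only [residual, LinearMap.coe_mk, AddHom.coe_mk, bracket, diffusion]
  refine Continuous.add (continuous_const.mul (Continuous.add ?_ ?_)) ?_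
  · exact continuous_finsetSum _ fun K _ =>
      continuous_const.mul (((hd _).sub continuous_const).div_const _)
  · exact continuous_finsetSum _ fun v _ =>
      continuous_const.mul (((hd _).sub continuous_const).div_const _)
  · exact continuous_finsetSum _ fun e _ =>
      (hrec e).mul ((hdel e).dotProduct continuous_const)

/-- A priori bound. Where the residual, tested with the potential `x` itself, is nonpositive, all
its terms are bounded; the ones with positive previous values control `x` there, and the dissipation
propagates the control along the edges of the two meshes. -/
lemma exists_bound_of_residual_nonpos (hM : M.IsDDFVMesh Ω) (hΩc : IsPreconnected Ω)
    (hΩo : IsOpen Ω) (hΩb : Bornology.IsBounded Ω) {lm lM : ℝ}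
    (hΛ : IsEllipticTensor Ω Λ lm lM) (hr : IsMeanFunction r)
    (hf : (∀ x y, f x y = max x y) ∨ (∀ x y, f x y = (x + y) / 2)) {Δt : ℝ} (hΔt : 0 < Δt)
    {u : (C ⊕ B) ⊕ V → ℝ} (hu : ∀ K, 0 ≤ u (.inl (.inl K))) (hu' : ∀ v, 0 ≤ u (.inr v))
    {K₀ : C} (hK₀ : 0 < u (.inl (.inl K₀))) {v₀ : V} (hv₀ : 0 < u (.inr v₀))
    (i : (C ⊕ B) ⊕ V) :
    ∃ c, ∀ x, M.residual W Λ f r Δt u x x ≤ 0 → |x i| ≤ c := by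
  -- the residual is the sum of the terms `t x`, each of which is bounded from below
  let t : ((C ⊕ B) ⊕ V → ℝ) → (C ⊕ V) ⊕ (I ⊕ B) → ℝ := fun x => Sum.elim
    (Sum.elim
      (fun K => M.mCell K / (2 * Δt) *
        ((Real.exp (x (.inl (.inl K)) - M.nodal W (.inl (.inl K))) - u (.inl (.inl K))) *
          x (.inl (.inl K))))
      (fun v => M.mDual v / (2 * Δt) *
        ((Real.exp (x (.inr v) - M.nodal W (.inr v)) - u (.inr v)) * x (.inr v))))
    (fun e => M.recon f r (M.density W x) e *
      (M.delta x e ⬝ᵥ (M.localMatrix Λ e *ᵥ M.delta x e)))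
  let b : (C ⊕ V) ⊕ (I ⊕ B) → ℝ := Sum.elim
    (Sum.elim
      (fun K => M.mCell K / (2 * Δt) * (Real.exp (-M.nodal W (.inl (.inl K))) +
        u (.inl (.inl K)) ^ 2 * Real.exp (M.nodal W (.inl (.inl K)))))
      (fun v => M.mDual v / (2 * Δt) * (Real.exp (-M.nodal W (.inr v)) +
        u (.inr v) ^ 2 * Real.exp (M.nodal W (.inr v)))))
    (fun _ => 0)
  have hmC : ∀ K, 0 < M.mCell K / (2 * Δt) := fun K => by have := hM.mCell_pos K; positivity
  have hmV : ∀ v, 0 < M.mDual v / (2 * Δt) := fun v => by have := hM.mDual_pos v; positivity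
  have hsum : ∀ x, M.residual W Λ f r Δt u x x = ∑ j, t x j := by
    intro x
    simp only [Fintype.sum_sum_type (α₁ := C ⊕ V), Fintype.sum_sum_type (α₁ := C) (α₂ := V), t,
      Sum.elim_inl, Sum.elim_inr, residual, LinearMap.coe_mk, AddHom.coe_mk, bracket, diffusion,
      density]
    congr 1
    rw [mul_add, Finset.mul_sum, Finset.mul_sum]
    congr 1 <;> refine Finset.sum_congr rfl fun _ _ => ?_ <;> field_simp
  choose c hc hcoer using fun e => hM.exists_localMatrix_coercive hΩb hΛ e
  have hrpos : ∀ x e, 0 < M.recon f r (M.density W x) e := fun x e =>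
    recon_pos hr hf (density_pos x) e
  have hb0 : ∀ j, 0 ≤ b j := by
    rintro ((K | v) | e)
    · exact mul_nonneg (hmC K).le (by positivity)
    · exact mul_nonneg (hmV v).le (by positivity)
    · exact le_rfl
  have htb : ∀ x j, -b j ≤ t x j := by
    rintro x ((K | v) | e)
    · simp only [t, b, Sum.elim_inl, ← mul_neg]
      exact mul_le_mul_of_nonneg_left (le_exp_sub_sub_mul _ _ _ (hu K)) (hmC K).le
    · simp only [t, b, Sum.elim_inl, Sum.elim_inr, ← mul_neg]
      exact mul_le_mul_of_nonneg_left (le_exp_sub_sub_mul _ _ _ (hu' v)) (hmV v).le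
    · simp only [t, b, Sum.elim_inr, neg_zero]
      refine mul_nonneg (hrpos x e).le (le_trans ?_ (hcoer e _))
      have := hc e
      positivity
  have hbound : ∀ x, M.residual W Λ f r Δt u x x ≤ 0 → ∀ j, t x j ≤ ∑ k, b k := fun x hx =>
    le_sum_of_sum_nonpos hb0 (htb x) (hsum x ▸ hx)
  set S := ∑ k, b k
  -- the mean of the densities at the ends of a primal or dual edge weighs the dissipation
  have hdiss : ∀ x, M.residual W Λ f r Δt u x x ≤ 0 → ∀ e,
      r (M.density W x (.inl (M.primK e))) (M.density W x (.inl (M.primL e))) *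
        (x (.inl (M.primK e)) - x (.inl (M.primL e))) ^ 2 ≤ 2 * S / c e ∧
      r (M.density W x (.inr (M.src e))) (M.density W x (.inr (M.tgt e))) *
        (x (.inr (M.src e)) - x (.inr (M.tgt e))) ^ 2 ≤ 2 * S / c e := by
    intro x hx e
    have h1 : M.recon f r (M.density W x) e *
        (M.delta x e ⬝ᵥ (M.localMatrix Λ e *ᵥ M.delta x e)) ≤ S := hbound x hx (.inr e)
    have h2 := (mul_le_mul_of_nonneg_left (hcoer e (M.delta x e)) (hrpos x e).le).trans h1
    obtain ⟨h3, h4⟩ := half_le_recon (M := M) hr hf (density_pos (M := M) (W := W) x) e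
    have hd0 : M.delta x e 0 = x (.inl (M.primK e)) - x (.inl (M.primL e)) := rfl
    have hd1 : M.delta x e 1 = x (.inr (M.src e)) - x (.inr (M.tgt e)) := rfl
    rw [hd0, hd1] at h2
    have hce := hc e
    set ρ := M.recon f r (M.density W x) e
    have hρ := hrpos x e
    constructor <;> rw [le_div_iff₀ hce]
    · have := mul_le_mul_of_nonneg_right h3 (mul_nonneg hce.le
        (sq_nonneg (x (.inl (M.primK e)) - x (.inl (M.primL e)))))
      nlinarith [mul_nonneg hρ.le (mul_nonneg hce.le
        (sq_nonneg (x (.inr (M.src e)) - x (.inr (M.tgt e)))))]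
    · have := mul_le_mul_of_nonneg_right h4 (mul_nonneg hce.le
        (sq_nonneg (x (.inr (M.src e)) - x (.inr (M.tgt e)))))
      nlinarith [mul_nonneg hρ.le (mul_nonneg hce.le
        (sq_nonneg (x (.inl (M.primK e)) - x (.inl (M.primL e)))))]
  have hstep : ∀ i j c₀, (∀ x, M.residual W Λ f r Δt u x x ≤ 0 →
      r (M.density W x i) (M.density W x j) * (x i - x j) ^ 2 ≤ c₀) →
      (∃ c, ∀ x, M.residual W Λ f r Δt u x x ≤ 0 → |x i| ≤ c) →
      ∃ c, ∀ x, M.residual W Λ f r Δt u x x ≤ 0 → |x j| ≤ c := by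
    rintro i j c₀ h ⟨k, hk⟩
    set p := M.nodal W i with hp
    set q := M.nodal W j with hq
    refine ⟨k + |p - q| + (1 + 2 * |p - q| + 8 * (c₀ / Real.exp (-k - p))), fun x hx => ?_⟩
    have hlog : ∀ l, Real.log (M.density W x l) = x l - M.nodal W l := fun l => Real.log_exp _
    have hki := abs_le.1 (hk x hx)
    have hL := hr.abs_log_sub_log_le (a := Real.exp (-k - p)) (x := M.density W x i)
      (y := M.density W x j) (q := p - q) (c := c₀) (Real.exp_pos _)
      (Real.exp_le_exp.2 (by linarith [hki.1])) (density_pos x j) (by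
        rw [hlog, hlog, ← hp, ← hq, show x i - p - (x j - q) + (p - q) = x i - x j by ring]
        exact h x hx)
    rw [hlog, hlog, ← hp, ← hq] at hL
    have h1 := abs_le.1 hL
    have h2 := abs_le.1 (le_refl |p - q|)
    rw [abs_le]
    constructor <;> linarith [h1.1, h1.2, h2.1, h2.2, hki.1, hki.2]
  refine hM.forall_of_propagates hΩc hΩo
    (p := fun i => ∃ c, ∀ x, M.residual W Λ f r Δt u x x ≤ 0 → |x i| ≤ c) (fun e => ?_)
    (fun e => ?_) (K := K₀) ?_ (v := v₀) ?_ i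
  · refine ⟨hstep _ _ _ fun x hx => (hdiss x hx e).1, hstep _ _ (2 * S / c e) fun x hx => ?_⟩
    rw [hr.symm _ _ (density_pos x _) (density_pos x _), ← neg_sub, neg_sq]
    exact (hdiss x hx e).1
  · refine ⟨hstep _ _ _ fun x hx => (hdiss x hx e).2, hstep _ _ (2 * S / c e) fun x hx => ?_⟩
    rw [hr.symm _ _ (density_pos x _) (density_pos x _), ← neg_sub, neg_sq]
    exact (hdiss x hx e).2
  · refine ⟨_, fun x hx => abs_le_of_exp_sub_sub_mul_le
      (q := M.nodal W (.inl (.inl K₀))) (c := S / (M.mCell K₀ / (2 * Δt))) hK₀ ?_⟩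
    rw [le_div_iff₀ (hmC K₀), mul_comm]
    exact hbound x hx (.inl (.inl K₀))
  · refine ⟨_, fun x hx => abs_le_of_exp_sub_sub_mul_le
      (q := M.nodal W (.inr v₀)) (c := S / (M.mDual v₀ / (2 * Δt))) hv₀ ?_⟩
    rw [le_div_iff₀ (hmV v₀), mul_comm]
    exact hbound x hx (.inl (.inr v₀))

/-- One step of the scheme is solvable as soon as the previous values on cells are nonnegative, and
positive for one primal and one dual cell. -/
lemma exists_isStep (hM : M.IsDDFVMesh Ω) (hΩc : IsPreconnected Ω)
    (hΩo : IsOpen Ω) (hΩb : Bornology.IsBounded Ω) {lm lM : ℝ}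
    (hΛ : IsEllipticTensor Ω Λ lm lM) (hr : IsMeanFunction r)
    (hf : (∀ x y, f x y = max x y) ∨ (∀ x y, f x y = (x + y) / 2)) {Δt : ℝ} (hΔt : 0 < Δt)
    {u : (C ⊕ B) ⊕ V → ℝ} (hu : ∀ K, 0 ≤ u (.inl (.inl K))) (hu' : ∀ v, 0 ≤ u (.inr v))
    {K₀ : C} (hK₀ : 0 < u (.inl (.inl K₀))) {v₀ : V} (hv₀ : 0 < u (.inr v₀)) :
    ∃ w, M.IsStep W Λ f r Δt u w := by
  classical
  let res := M.residual W Λ f r Δt u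
  let F : EuclideanSpace ℝ ((C ⊕ B) ⊕ V) → EuclideanSpace ℝ ((C ⊕ B) ⊕ V) := fun x =>
    WithLp.toLp 2 fun i => res x (fun j => if i = j then 1 else 0)
  have hpair : ∀ (x : EuclideanSpace ℝ ((C ⊕ B) ⊕ V)) (ψ : (C ⊕ B) ⊕ V → ℝ),
      res x ψ = ∑ i, ψ i * F x i := fun x ψ => by
    rw [LinearMap.pi_apply_eq_sum_univ (res x) ψ]
    rfl
  have hF : Continuous F := (PiLp.continuous_toLp 2 _).comp <| continuous_pi fun i =>
    (continuous_residual hr hf Δt u _).comp (PiLp.continuous_ofLp 2 _)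
  have hinner : ∀ x : EuclideanSpace ℝ ((C ⊕ B) ⊕ V), inner ℝ (F x) x = res x x := fun x => by
    rw [hpair, PiLp.inner_apply]
    rfl
  choose c hc using fun i => exists_bound_of_residual_nonpos (W := W) hM hΩc hΩo hΩb hΛ hr hf hΔt
    hu hu' hK₀ hv₀ i
  obtain ⟨x, hx⟩ : ∃ x, F x = 0 := by
    refine exists_eq_zero_of_inner_pos hF (R := 1 + ∑ i, |c i|)
      (by linarith [Finset.sum_nonneg fun i (_ : i ∈ Finset.univ) => abs_nonneg (c i)])
      fun x hx => ?_
    rw [hinner]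
    by_contra! hneg
    have hnorm := norm_le_sum_abs x
    have : ∑ i, |x i| ≤ ∑ i, |c i| := Finset.sum_le_sum fun i _ =>
      (hc i x hneg).trans (le_abs_self _)
    linarith
  refine ⟨M.density W x, density_pos _, fun ψ => ?_⟩
  rw [potential_density]
  have := hpair x ψ
  simp only [hx, PiLp.zero_apply, mul_zero, Finset.sum_const_zero] at this
  exact this

/-! ### Entropy dissipation -/

/-- A solution of one step of the scheme has the same mass as the previous values on each of the two
meshes: the test vectors equal to one on one mesh and to zero on the other have no differences. -/
lemma IsStep.mass_eq {Δt : ℝ} (hΔt : 0 < Δt) {u w : (C ⊕ B) ⊕ V → ℝ}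
    (h : M.IsStep W Λ f r Δt u w) :
    ∑ K, M.mCell K * (w (.inl (.inl K)) - u (.inl (.inl K))) = 0 ∧
      ∑ v, M.mDual v * (w (.inr v) - u (.inr v)) = 0 := by
  have key : ∀ a b : ℝ, M.diffusion Λ f r w (M.potential W w)
      (Sum.elim (fun _ => a) (fun _ => b)) = 0 := by
    intro a b
    refine Finset.sum_eq_zero fun e _ => ?_
    have : M.delta (Sum.elim (fun _ => a) (fun _ => b)) e = 0 := by
      ext i; fin_cases i <;> simp [delta]
    rw [this, mulVec_zero, dotProduct_zero, mul_zero]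
  have h1 := h.2 (Sum.elim (fun _ => 1) (fun _ => 0))
  have h2 := h.2 (Sum.elim (fun _ => 0) (fun _ => 1))
  rw [key] at h1 h2
  simp only [bracket, Sum.elim_inl, Sum.elim_inr, mul_one, mul_zero, zero_mul,
    Finset.sum_const_zero, add_zero, mul_div_assoc', ← Finset.sum_div] at h1 h2
  constructor
  · field_simp at h1; simpa using h1
  · field_simp at h2; simpa using h2

/-- The entropy inequality: the scheme is tested with the discrete potential. -/
lemma IsStep.entropy_dissipation (hM : M.IsDDFVMesh Ω) [Nonempty C] [Nonempty V] {Δt : ℝ}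
    (hΔt : 0 < Δt) {m : ℝ} (hm : 0 < m) {u w : (C ⊕ B) ⊕ V → ℝ}
    (hu : ∀ K, 0 ≤ u (.inl (.inl K))) (hu' : ∀ v, 0 ≤ u (.inr v))
    (h : M.IsStep W Λ f r Δt u w) :
    (M.entropy W m w - M.entropy W m u) / Δt + M.dissipation W Λ f r w ≤ 0 := by
  obtain ⟨hmass, hmass'⟩ := h.mass_eq hΔt
  have hρ : 0 < m * (∑ L : C, M.mCell L * Real.exp (-W (M.center L)))⁻¹ :=
    mul_pos hm (inv_pos.2 (Finset.sum_pos (fun L _ => mul_pos (hM.mCell_pos L) (Real.exp_pos _))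
      Finset.univ_nonempty))
  have hρ' : 0 < m * (∑ v : V, M.mDual v * Real.exp (-W (M.vertex v)))⁻¹ :=
    mul_pos hm (inv_pos.2 (Finset.sum_pos (fun v _ => mul_pos (hM.mDual_pos v) (Real.exp_pos _))
      Finset.univ_nonempty))
  have h1 := sum_entropy_sub_le (q := fun K => W (M.center K)) hρ (fun K => (hM.mCell_pos K).le)
    hu (fun K => h.1 (.inl (.inl K))) hmass (s := fun K => M.steady W m (.inl (.inl K)))
    (fun _ => rfl)
  have h2 := sum_entropy_sub_le (q := fun v => W (M.vertex v)) hρ' (fun v => (hM.mDual_pos v).le)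
    hu' (fun v => h.1 (.inr v)) hmass' (s := fun v => M.steady W m (.inr v)) (fun _ => rfl)
  have h3 := h.2 (M.potential W w)
  have h4 : M.bracket (fun i => (w i - u i) / Δt) (M.potential W w) =
      (1 / 2) * (∑ K, M.mCell K * (w (.inl (.inl K)) - u (.inl (.inl K))) *
        (Real.log (w (.inl (.inl K))) + W (M.center K)) +
        ∑ v, M.mDual v * (w (.inr v) - u (.inr v)) *
        (Real.log (w (.inr v)) + W (M.vertex v))) / Δt := by
    rw [mul_div_assoc, add_div, Finset.sum_div, Finset.sum_div, bracket]
    congr 2 <;> refine Finset.sum_congr rfl fun _ _ => ?_ <;>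
      simp only [potential, nodal, primalCenter, Sum.elim_inl, Sum.elim_inr] <;> ring
  have h5 : M.entropy W m w - M.entropy W m u ≤
      (1 / 2) * (∑ K, M.mCell K * (w (.inl (.inl K)) - u (.inl (.inl K))) *
        (Real.log (w (.inl (.inl K))) + W (M.center K)) +
        ∑ v, M.mDual v * (w (.inr v) - u (.inr v)) *
        (Real.log (w (.inr v)) + W (M.vertex v))) := by
    simp only [entropy, bracket, mul_one]
    linarith
  calc _ ≤ M.bracket (fun i => (w i - u i) / Δt) (M.potential W w) +
        M.dissipation W Λ f r w := by
        rw [h4]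
        gcongr
    _ = 0 := h3
    _ ≤ 0 := le_rfl

end MeshData

/-! ### Solvability and dissipation along the scheme -/

theorem proposition4p1 {C V I B : Type*} [Fintype C] [Fintype V] [Fintype I] [Fintype B]
    (Ω : Set Plane) (hΩ : IsPolygonalDomain Ω)
    (M : MeshData C V I B) (hM : M.IsDDFVMesh Ω)
    (W : Plane → ℝ) (hW : ContDiffOn ℝ 1 W (closure Ω))
    (Λ : Plane → Matrix (Fin 2) (Fin 2) ℝ) (lm lM : ℝ) (hΛ : IsEllipticTensor Ω Λ lm lM)
    (u₀ : Plane → ℝ) (hu₀ : MemLp u₀ 2 (volume.restrict Ω))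
    (hu₀_nonneg : ∀ᵐ x ∂volume.restrict Ω, 0 ≤ u₀ x) (hmass : 0 < ∫ x in Ω, u₀ x)
    (r : ℝ → ℝ → ℝ) (hr : IsMeanFunction r)
    (f : ℝ → ℝ → ℝ) (hf : (∀ x y, f x y = max x y) ∨ (∀ x y, f x y = (x + y) / 2))
    (Δt : ℝ) (hΔt : 0 < Δt)
    (n : ℕ) (u : ℕ → (C ⊕ B) ⊕ V → ℝ) (hu_zero : u 0 = M.initial u₀)
    (hu_step : ∀ k < n, M.IsStep W Λ f r Δt (u k) (u (k + 1))) :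
    (∃ w, M.IsStep W Λ f r Δt (u n) w) ∧
    ∀ w, M.IsStep W Λ f r Δt (u n) w →
      (M.entropy W (∫ x in Ω, u₀ x) w - M.entropy W (∫ x in Ω, u₀ x) (u n)) / Δt +
        M.dissipation W Λ f r w ≤ 0 := by
  obtain ⟨_, -, hpoly⟩ := hΩ
  have hfin : IsFiniteMeasure (volume.restrict Ω) :=
    isFiniteMeasure_restrict.2 hpoly.isBounded.measure_lt_top.ne
  have hint : IntegrableOn u₀ Ω := hu₀.integrable one_le_two
  obtain ⟨K₀, hK₀⟩ := exists_setIntegral_pos (fun K => (hM.cell_polygon K).isOpen) hM.cell_subset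
    hM.cell_disjoint hM.ae_eq_iUnion_cell hint hmass
  obtain ⟨v₀, hv₀⟩ := exists_setIntegral_pos (fun v => (hM.dual_polygon v).isOpen) hM.dual_subset
    hM.dual_disjoint hM.ae_eq_iUnion_dualCell hint hmass
  have : Nonempty C := ⟨K₀⟩
  have : Nonempty V := ⟨v₀⟩
  have hnonneg : ∀ P ⊆ Ω, 0 ≤ ∫ x in P, u₀ x := fun P hP =>
    setIntegral_nonneg_of_ae_restrict (ae_restrict_of_ae_restrict_of_subset hP hu₀_nonneg)
  -- after the first step the values are positive; the initial ones are means of `u₀`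
  obtain ⟨h1, h2, h3, h4⟩ : (∀ K, 0 ≤ u n (.inl (.inl K))) ∧ (∀ v, 0 ≤ u n (.inr v)) ∧
      0 < u n (.inl (.inl K₀)) ∧ 0 < u n (.inr v₀) := by
    rcases n with _ | k
    · rw [hu_zero]
      have hC := fun K => one_div_pos.2 (hM.mCell_pos K)
      have hV := fun v => one_div_pos.2 (hM.mDual_pos v)
      exact ⟨fun K => mul_nonneg (hC K).le (hnonneg _ (hM.cell_subset K)),
        fun v => mul_nonneg (hV v).le (hnonneg _ (hM.dual_subset v)),
        mul_pos (hC K₀) hK₀, mul_pos (hV v₀) hv₀⟩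
    · have hpos := (hu_step k (Nat.lt_succ_self k)).1
      exact ⟨fun _ => (hpos _).le, fun _ => (hpos _).le, hpos _, hpos _⟩
  exact ⟨MeshData.exists_isStep hM hpoly.isConnected.isPreconnected hpoly.isOpen hpoly.isBounded
    hΛ hr hf hΔt h1 h2 h3 h4, fun w hw => hw.entropy_dissipation hM hΔt hmass h1 h2⟩
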